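/- **Theorem A.** Let $\mathbb T^2=\mathbb R^2/\mathbb Z^2$, and let $\mathrm{Diff}(\mathbb T^2)$ be the set of real-analytic diffeomorphisms of $\mathbb T^2$ homotopic to the identity. For $r>0$ let $A^r=\{(x,y)\in\mathbb C^2: |\mathrm{Im}\,x|<r,\ |\mathrm{Im}\,y|<r\}$, let $C^\omega_r(\mathbb T^2)$ be the space of $\mathbb Z^2$-periodic functions $f:\mathbb R^2\to\mathbb R$ that extend to bounded holomorphic functions on $A^r$, with the norm $|f|_r=\sup_{A^r}|f|$, and let $\mathcal D_r=C^\omega_r(\mathbb T^2)\times C^\omega_r(\mathbb T^2)$ with the norm $\max_{i=1,2}|f_i|_r$. A pair $(f_1,f_2)\in\mathcal D_r$ represents $F\in\mathrm{Diff}(\mathbb T^2)$ if $(x,y)\mapsto(x+f_1(x,y),\,y+f_2(x,y))$ is a lift of $F$. Give $\mathrm{Diff}(\mathbb T^2)$ the inductive limit topology $\tau$: a set $O\subset\mathrm{Diff}(\mathbb T^2)$ is open if and only if for every $r>0$ the set of elements of $\mathcal D_r$ that represent a diffeomorphism in $O$ is open in the set of all elements of $\mathcal D_r$ that represent a diffeomorphism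 in $\mathrm{Diff}(\mathbb T^2)$. For $\alpha\in[0,1]$ let $R_\alpha(x,y)=(x+\alpha,y)$, let $\mathcal A_\alpha$ be the set of all $F\in\mathrm{Diff}(\mathbb T^2)$ of the form $F=T^{-1}\circ R_\alpha\circ T$, where $T$ is a real-analytic area-preserving diffeomorphism of $\mathbb T^2$, and let $\overline{\mathcal A_\alpha}$ be the closure of $\mathcal A_\alpha$ in $(\mathrm{Diff}(\mathbb T^2),\tau)$. A map of $\mathbb T^2$ is called uniquely ergodic if it has exactly one invariant Borel probability measure. Then there is a dense $G_\delta$ subset $S$ of $[0,1]$ such that for every $\alpha\in S$ the uniquely ergodic diffeomorphisms in $\overline{\mathcal A_\alpha}$ form a dense subset of $\overline{\mathcal A_\alpha}$ (with the topology induced by $\tau$). -/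

import Mathlib

open scoped BoundedContinuousFunction

noncomputable section

namespace AnalyticTorus

/-- The torus `ℝ² / ℤ²`. Its `volume` is the normalized Haar (area) measure. -/
abbrev Torus : Type := UnitAddCircle × UnitAddCircle

/-- The covering projection `ℝ² → ℝ² / ℤ²`. -/
def proj (p : ℝ × ℝ) : Torus := ((p.1 : UnitAddCircle), (p.2 : UnitAddCircle))

/-- A self-map of the torus is real-analytic if it has a real-analytic lift to `ℝ²`. -/
def IsRealAnalytic (F : Torus → Torus) : Prop :=
  ∃ f : ℝ × ℝ → ℝ × ℝ, AnalyticOnNhd ℝ f Set.univ ∧ ∀ p, F (proj p) = proj (f p)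

/-- Real-analytic diffeomorphisms of the torus (of any homotopy class). -/
structure AnalyticDiffeo where
  toHomeomorph : Torus ≃ₜ Torus
  analytic : IsRealAnalytic toHomeomorph
  analytic_symm : IsRealAnalytic toHomeomorph.symm

/-- `Diff(𝕋²)`: real-analytic diffeomorphisms of the torus homotopic to the identity. -/
structure Diff extends AnalyticDiffeo where
  homotopic_id : ContinuousMap.Homotopic (toHomeomorph : C(Torus, Torus)) (ContinuousMap.id Torus)

/-- The complex neighbourhood `A^r = {|Im x| < r, |Im y| < r}` of the real plane. -/
def strip (r : ℝ) : Set (ℂ × ℂ) := {z | |z.1.im| < r ∧ |z.2.im| < r}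

/-- A real point, seen in the complex neighbourhood `A^r`. -/
def realPoint {r : ℝ} (hr : 0 < r) (p : ℝ × ℝ) : strip r :=
  ⟨((p.1 : ℂ), (p.2 : ℂ)), by simp [strip, hr]⟩

/-- `C_r^ω(𝕋²)`: the (bounded) holomorphic extensions to `A^r` of real-valued `ℤ²`-periodic
functions on `ℝ²`, with the metric of the supremum norm over `A^r`. -/
def periodicAnalytic {r : ℝ} (hr : 0 < r) : Set (strip r →ᵇ ℂ) :=
  {φ | (∃ Φ : ℂ × ℂ → ℂ, DifferentiableOn ℂ Φ (strip r) ∧ ∀ z : strip r, φ z = Φ z) ∧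
    ∃ f : ℝ × ℝ → ℝ, (∀ x y, f (x + 1, y) = f (x, y) ∧ f (x, y + 1) = f (x, y)) ∧
      ∀ p, φ (realPoint hr p) = (f p : ℂ)}

/-- `𝒟_r`: pairs of functions in `C_r^ω(𝕋²)`, with the maximum of the two supremum norms. -/
abbrev DispSpace {r : ℝ} (hr : 0 < r) : Type := periodicAnalytic hr × periodicAnalytic hr

/-- The pair `(f₁, f₂) ∈ 𝒟_r` represents `F`, i.e. `(x, y) ↦ (x + f₁(x, y), y + f₂(x, y))` is a
lift of `F`. -/
def IsDisplacement {r : ℝ} (hr : 0 < r) (φ : DispSpace hr) (F : Diff) : Prop :=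
  ∀ p : ℝ × ℝ, F.toHomeomorph (proj p) =
    proj (p.1 + (φ.1.1 (realPoint hr p)).re, p.2 + (φ.2.1 (realPoint hr p)).re)

/-- The inductive limit topology: `O` is open iff, for every `r > 0`, the elements of `𝒟_r` that
represent diffeomorphisms in `O` form an open set relative to those that represent
diffeomorphisms. -/
instance inductiveLimitTopology : TopologicalSpace Diff where
  IsOpen O := ∀ (r : ℝ) (hr : 0 < r), ∃ U : Set (DispSpace hr), IsOpen U ∧
    ∀ φ F, IsDisplacement hr φ F → (φ ∈ U ↔ F ∈ O)
  isOpen_univ := fun _ _ => ⟨Set.univ, isOpen_univ, fun _ _ _ => by simp⟩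
  isOpen_inter := fun O₁ O₂ h₁ h₂ r hr => by
    obtain ⟨U₁, hU₁, e₁⟩ := h₁ r hr
    obtain ⟨U₂, hU₂, e₂⟩ := h₂ r hr
    exact ⟨U₁ ∩ U₂, hU₁.inter hU₂, fun φ F h => and_congr (e₁ φ F h) (e₂ φ F h)⟩
  isOpen_sUnion := fun 𝒪 h r hr => by
    choose! U hU e using fun O hO => h O hO r hr
    refine ⟨⋃ O ∈ 𝒪, U O, isOpen_biUnion hU, fun φ F hF => ?_⟩
    simp only [Set.mem_iUnion, Set.mem_sUnion, exists_prop]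
    exact exists_congr fun O => and_congr_right fun hO => e O hO φ F hF

/-- The rotation `R_α (x, y) = (x + α, y)`. -/
def torusRotation (α : ℝ) (p : Torus) : Torus := (p.1 + (α : UnitAddCircle), p.2)

/-- `𝒜_α`: diffeomorphisms of the form `T⁻¹ ∘ R_α ∘ T` with `T` a real-analytic area-preserving
diffeomorphism of the torus. -/
def conjugates (α : ℝ) : Set Diff :=
  {F | ∃ T : AnalyticDiffeo,
    MeasureTheory.MeasurePreserving T.toHomeomorph MeasureTheory.volume MeasureTheory.volume ∧
      ∀ p, F.toHomeomorph p = T.toHomeomorph.symm (torusRotation α (T.toHomeomorph p))}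

/-- There is exactly one invariant Borel probability measure. -/
def UniquelyErgodic (F : Torus → Torus) : Prop :=
  ∃! μ : MeasureTheory.Measure Torus,
    MeasureTheory.IsProbabilityMeasure μ ∧ MeasureTheory.MeasurePreserving F μ μ

end AnalyticTorus

end

noncomputable section

namespace AnalyticTorus

open Metric Set Filter Topology MeasureTheory


/-! `S` consists of the super-Liouville `α`, a dense Gδ by Baire. Conjugation by an area-preserving
`T` is continuous for the inductive limit topology (`continuous_conjDiff`), preserves `conjugates α`
and hence its closure, and preserves unique ergodicity. It therefore suffices to find uniquely
ergodic elements of the closure arbitrarily near `R_α` itself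
(`exists_uniquelyErgodic_near_rotation`).

These are skew products `(x + α, y + ψ(x))`, where `ψ` is a sum of coboundaries of `sin (2πq_n x)`.
On the strip `|Im z| < 1` such a coboundary has size at most `2 |sin (πqα)| exp (2πq)`, which is
tiny along the good denominators of `α`. If `Φ_n` is the partial sum of the waves, the skew product
of the coboundary of `Φ_n` is conjugate to `R_α`, so the limit lies in the closure.

Unique ergodicity (`uniquelyErgodic_skew`) is tested on the characters `e(mx + ky)`. For `k ≠ 0`
such a character is the product of the twist `e(mx + kΦ_n(x))` and the almost invariant function
`e(k(y - Φ_n(x)))`. The twist is its mean plus, up to a small error, a coboundary of some `h_n`, and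
the coboundary contributes little if the tail of `ψ` is small against `‖h_n‖`. The tail is chosen
after `h_n`, so this can be arranged. The means tend to `0`: by Fejér's lemma, adding a wave of high
frequency multiplies the mean, up to a small error, by the integral of `e(k sin 2πx)`, whose modulus
is less than `1` (`norm_integral_twist_wave_lt_one`). -/

/-! ### Holomorphic extension of real-analytic functions to strips -/

/-- The inclusion `ℝ² → ℂ²`. -/
def toComplex (p : ℝ × ℝ) : ℂ × ℂ := ((p.1 : ℂ), (p.2 : ℂ))

/-- The coordinatewise real part `ℂ² → ℝ²`. -/
def rePart (z : ℂ × ℂ) : ℝ × ℝ := (z.1.re, z.2.re)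

lemma dist_toComplex (p q : ℝ × ℝ) : dist (toComplex p) (toComplex q) = dist p q := by
  simp [toComplex, Prod.dist_eq, Complex.dist_of_im_eq, Real.dist_eq]

lemma toComplex_add (p q : ℝ × ℝ) : toComplex (p + q) = toComplex p + toComplex q := by
  simp [toComplex]

lemma dist_rePart_lt {z : ℂ × ℂ} {r : ℝ} (hz : z ∈ strip r) :
    dist z (toComplex (rePart z)) < r := by
  simp only [toComplex, rePart, Prod.dist_eq, max_lt_iff]
  constructor <;> rw [Complex.dist_of_re_eq (by simp)] <;> simp [hz.1, hz.2]

lemma dist_rePart_le {z w : ℂ × ℂ} : dist (rePart z) (rePart w) ≤ dist z w := by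
  simp only [rePart, Prod.dist_eq]
  refine max_le_max ?_ ?_
  · rw [Real.dist_eq, ← Complex.sub_re, dist_eq_norm]; exact Complex.abs_re_le_norm _
  · rw [Real.dist_eq, ← Complex.sub_re, dist_eq_norm]; exact Complex.abs_re_le_norm _

@[simp] lemma rePart_toComplex (p : ℝ × ℝ) : rePart (toComplex p) = p := by
  simp [rePart, toComplex]

lemma isOpen_strip (r : ℝ) : IsOpen (strip r) := by
  have h1 : Continuous fun z : ℂ × ℂ => |z.1.im| := by fun_prop
  have h2 : Continuous fun z : ℂ × ℂ => |z.2.im| := by fun_prop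
  exact (isOpen_lt h1 continuous_const).inter (isOpen_lt h2 continuous_const)

lemma toComplex_mem_strip {r : ℝ} (hr : 0 < r) (p : ℝ × ℝ) : toComplex p ∈ strip r := by
  simp [strip, toComplex, hr]

/-- The complexification of a real power series in two variables. -/
def complexifySeries (p : FormalMultilinearSeries ℝ (ℝ × ℝ) ℝ) :
    FormalMultilinearSeries ℂ (ℂ × ℂ) ℂ := fun n =>
  ∑ s : Finset (Fin n), ((p n (s.piecewise (fun _ => (1, 0)) fun _ => (0, 1)) : ℝ) : ℂ) •
    (ContinuousMultilinearMap.mkPiAlgebra ℂ (Fin n) ℂ).compContinuousLinearMap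
      (fun i => if i ∈ s then ContinuousLinearMap.fst ℂ ℂ ℂ else ContinuousLinearMap.snd ℂ ℂ ℂ)

/-- There is one summand for each of the `2 ^ n` subsets; the basis vectors and the coordinate
projections have norm at most one. -/
lemma norm_complexifySeries_le (p : FormalMultilinearSeries ℝ (ℝ × ℝ) ℝ) (n : ℕ) :
    ‖complexifySeries p n‖ ≤ 2 ^ n * ‖p n‖ := by
  have key : ∀ s : Finset (Fin n),
      ‖((p n (s.piecewise (fun _ => (1, 0)) fun _ => (0, 1)) : ℝ) : ℂ) •
        (ContinuousMultilinearMap.mkPiAlgebra ℂ (Fin n) ℂ).compContinuousLinearMap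
          (fun i => if i ∈ s then ContinuousLinearMap.fst ℂ ℂ ℂ
            else ContinuousLinearMap.snd ℂ ℂ ℂ)‖ ≤ ‖p n‖ := by
    intro s
    rw [norm_smul]
    have h1 : ‖((p n (s.piecewise (fun _ => (1, 0)) fun _ => (0, 1)) : ℝ) : ℂ)‖ ≤ ‖p n‖ := by
      rw [Complex.norm_real]
      refine ((p n).le_opNorm _).trans ?_
      refine mul_le_of_le_one_right (norm_nonneg _) (Finset.prod_le_one (fun _ _ => norm_nonneg _) ?_)
      intro i _
      by_cases hi : i ∈ s <;> simp [hi, Prod.norm_def]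
    have h2 : ‖(ContinuousMultilinearMap.mkPiAlgebra ℂ (Fin n) ℂ).compContinuousLinearMap
          (fun i => if i ∈ s then ContinuousLinearMap.fst ℂ ℂ ℂ
            else ContinuousLinearMap.snd ℂ ℂ ℂ)‖ ≤ 1 := by
      refine ((ContinuousMultilinearMap.mkPiAlgebra ℂ (Fin n)
        ℂ).norm_compContinuousLinearMap_le _).trans ?_
      rw [ContinuousMultilinearMap.norm_mkPiAlgebra, one_mul]
      refine Finset.prod_le_one (fun _ _ => norm_nonneg _) ?_
      intro i _
      split_ifs
      · exact ContinuousLinearMap.norm_fst_le ..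
      · exact ContinuousLinearMap.norm_snd_le ..
    calc _ ≤ ‖p n‖ * 1 := mul_le_mul h1 h2 (norm_nonneg _) (norm_nonneg _)
      _ = _ := mul_one _
  refine (norm_sum_le_of_le _ fun s _ => key s).trans ?_
  simp

/-- Expanding `v = v.1 • (1, 0) + v.2 • (0, 1)` by multilinearity gives exactly the sum that defines
the complexified series. -/
lemma complexifySeries_apply_toComplex (p : FormalMultilinearSeries ℝ (ℝ × ℝ) ℝ) (n : ℕ)
    (v : ℝ × ℝ) :
    complexifySeries p n (fun _ => toComplex v) = ((p n fun _ => v : ℝ) : ℂ) := by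
  have hv : (fun _ : Fin n => v) =
      (fun _ => v.1 • ((1 : ℝ), (0 : ℝ))) + fun _ => v.2 • ((0 : ℝ), (1 : ℝ)) := by
    funext i; ext <;> simp
  rw [hv, ContinuousMultilinearMap.map_add_univ, Complex.ofReal_sum]
  simp only [complexifySeries, sum_apply]
  refine Finset.sum_congr rfl fun s _ => ?_
  have hs : (s.piecewise (fun _ : Fin n => v.1 • ((1 : ℝ), (0 : ℝ)))
      fun _ => v.2 • ((0 : ℝ), (1 : ℝ))) = fun i => (if i ∈ s then v.1 else v.2) •
        s.piecewise (fun _ => ((1 : ℝ), (0 : ℝ))) (fun _ => (0, 1)) i := by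
    funext i; by_cases hi : i ∈ s <;> simp [hi]
  rw [hs, ContinuousMultilinearMap.map_smul_univ]
  simp only [smul_apply,
    ContinuousMultilinearMap.compContinuousLinearMap_apply,
    ContinuousMultilinearMap.mkPiAlgebra_apply, smul_eq_mul, Complex.ofReal_mul,
    Complex.ofReal_prod]
  rw [mul_comm]
  congr 1
  refine Finset.prod_congr rfl fun i _ => ?_
  split_ifs <;> simp [toComplex]

lemma complexifySeries_radius_pos {p : FormalMultilinearSeries ℝ (ℝ × ℝ) ℝ} (hp : 0 < p.radius) :
    0 < (complexifySeries p).radius := by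
  obtain ⟨C, r, hC, hr, h⟩ := p.le_mul_pow_of_radius_pos hp
  have : ((Real.toNNReal (2 * r)⁻¹ : NNReal) : ENNReal) ≤ (complexifySeries p).radius := by
    refine FormalMultilinearSeries.le_radius_of_bound _ C fun n => ?_
    rw [Real.coe_toNNReal _ (by positivity)]
    calc ‖complexifySeries p n‖ * ((2 * r)⁻¹) ^ n
        ≤ (2 ^ n * (C * r ^ n)) * ((2 * r)⁻¹) ^ n := by
          gcongr
          exact (norm_complexifySeries_le p n).trans (by gcongr; exact h n)
      _ = C := by
          rw [inv_pow, mul_pow]; field_simp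
  refine lt_of_lt_of_le ?_ this
  simp only [ENNReal.coe_pos, Real.toNNReal_pos]
  positivity

/-- `f` has a holomorphic extension, bounded by `M`, to the complex polydisc of radius `ρ`
about `x`. -/
def HasExtension (f : ℝ × ℝ → ℝ) (x : ℝ × ℝ) (ρ M : ℝ) : Prop :=
  ∃ Φ : ℂ × ℂ → ℂ, DifferentiableOn ℂ Φ (ball (toComplex x) ρ) ∧
    (∀ z ∈ ball (toComplex x) ρ, ‖Φ z‖ ≤ M) ∧ ∀ p ∈ ball x ρ, Φ (toComplex p) = f p

lemma HasExtension.mono {f : ℝ × ℝ → ℝ} {x y : ℝ × ℝ} {ρ ρ' M M' : ℝ}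
    (h : HasExtension f x ρ M) (hy : dist y x + ρ' ≤ ρ) (hM : M ≤ M') :
    HasExtension f y ρ' M' := by
  obtain ⟨Φ, h1, h2, h3⟩ := h
  have hsub : ball (toComplex y) ρ' ⊆ ball (toComplex x) ρ :=
    ball_subset_ball' (by rw [dist_toComplex]; linarith)
  exact ⟨Φ, h1.mono hsub, fun z hz => (h2 z (hsub hz)).trans hM,
    fun p hp => h3 p (ball_subset_ball' (by linarith) hp)⟩

lemma exists_hasExtension_of_analyticAt {f : ℝ × ℝ → ℝ} {x : ℝ × ℝ} (hf : AnalyticAt ℝ f x) :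
    ∃ ρ > 0, ∃ M, HasExtension f x ρ M := by
  obtain ⟨p, hp⟩ := hf
  obtain ⟨R, hR⟩ := hp
  have hpos : 0 < p.radius := hR.r_pos.trans_le hR.r_le
  have hP := (complexifySeries p).hasFPowerSeriesOnBall (complexifySeries_radius_pos hpos)
  set Φ : ℂ × ℂ → ℂ := fun z => (complexifySeries p).sum (z - toComplex x) with hΦ
  have hd : DifferentiableOn ℂ (complexifySeries p).sum (Metric.eball 0 (complexifySeries p).radius) :=
    hP.differentiableOn
  have hnhds : ∀ᶠ w in 𝓝 (0 : ℂ × ℂ), w ∈ Metric.eball 0 (complexifySeries p).radius ∧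
      ‖(complexifySeries p).sum w‖ < ‖(complexifySeries p).sum 0‖ + 1 := by
    have h0 : Metric.eball 0 (complexifySeries p).radius ∈ 𝓝 (0 : ℂ × ℂ) :=
      Metric.eball_mem_nhds _ hP.r_pos
    refine Filter.Eventually.and h0 ?_
    exact (hd.continuousOn.continuousAt h0).norm.eventually_lt continuousAt_const (by simp)
  have hnhds' : ∀ᶠ w in 𝓝 (0 : ℝ × ℝ), w ∈ Metric.eball 0 R := Metric.eball_mem_nhds _ hR.r_pos
  obtain ⟨ρ₁, hρ₁, h1⟩ := Metric.eventually_nhds_iff_ball.1 hnhds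
  obtain ⟨ρ₂, hρ₂, h2⟩ := Metric.eventually_nhds_iff_ball.1 hnhds'
  refine ⟨min ρ₁ ρ₂, lt_min hρ₁ hρ₂, ‖(complexifySeries p).sum 0‖ + 1, Φ, ?_, ?_, ?_⟩
  · refine hd.comp (by fun_prop) fun z hz => (h1 _ ?_).1
    rw [mem_ball_zero_iff, ← dist_eq_norm]
    exact lt_of_lt_of_le hz (min_le_left _ _)
  · intro z hz
    refine (h1 _ ?_).2.le
    rw [mem_ball_zero_iff, ← dist_eq_norm]
    exact lt_of_lt_of_le hz (min_le_left _ _)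
  · intro q hq
    have hq' : q - x ∈ ball (0 : ℝ × ℝ) ρ₂ := by
      rw [mem_ball_zero_iff, ← dist_eq_norm]
      exact lt_of_lt_of_le hq (min_le_right _ _)
    have hs := (hR.hasSum (h2 _ hq')).tsum_eq
    rw [add_sub_cancel] at hs
    have hc : toComplex q - toComplex x = toComplex (q - x) := by
      simp [toComplex]
    simp only [hΦ, hc, FormalMultilinearSeries.sum, complexifySeries_apply_toComplex]
    rw [← hs, Complex.ofReal_tsum]

/-- Compactness of the unit square gives a common radius and bound there; integer translations carry
them to the whole plane. -/
lemma exists_uniform_hasExtension {f : ℝ × ℝ → ℝ} (hf : AnalyticOnNhd ℝ f univ)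
    (hper : ∀ (p : ℝ × ℝ) (m n : ℤ), f (p + ((m : ℝ), (n : ℝ))) = f p) :
    ∃ ρ > 0, ∃ M, ∀ x, HasExtension f x ρ M := by
  have hK : IsCompact (Icc (0 : ℝ) 1 ×ˢ Icc (0 : ℝ) 1) := isCompact_Icc.prod isCompact_Icc
  have : ∃ ρ > 0, ∃ M, ∀ x ∈ Icc (0 : ℝ) 1 ×ˢ Icc (0 : ℝ) 1, HasExtension f x ρ M := by
    refine hK.induction_on (p := fun s => ∃ ρ > 0, ∃ M, ∀ x ∈ s, HasExtension f x ρ M)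
      ⟨1, one_pos, 0, by simp⟩ ?_ ?_ ?_
    · rintro s t hst ⟨ρ, hρ, M, h⟩
      exact ⟨ρ, hρ, M, fun x hx => h x (hst hx)⟩
    · rintro s t ⟨ρ, hρ, M, h⟩ ⟨ρ', hρ', M', h'⟩
      refine ⟨min ρ ρ', lt_min hρ hρ', max M M', ?_⟩
      rintro x (hx | hx)
      · exact (h x hx).mono (by simp) (le_max_left _ _)
      · exact (h' x hx).mono (by simp) (le_max_right _ _)
    · intro x _
      obtain ⟨ρ, hρ, M, h⟩ := exists_hasExtension_of_analyticAt (hf x (mem_univ x))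
      refine ⟨ball x (ρ / 2), mem_nhdsWithin_of_mem_nhds (ball_mem_nhds _ (by positivity)),
        ρ / 2, by positivity, M, fun y hy => h.mono ?_ le_rfl⟩
      have := mem_ball.1 hy
      linarith
  obtain ⟨ρ, hρ, M, h⟩ := this
  refine ⟨ρ, hρ, M, fun x => ?_⟩
  set y : ℝ × ℝ := (Int.fract x.1, Int.fract x.2) with hy
  set k : ℝ × ℝ := (((⌊x.1⌋ : ℤ) : ℝ), ((⌊x.2⌋ : ℤ) : ℝ)) with hk
  have hx : x = y + k := by ext <;> simp [hy, hk]
  obtain ⟨Φ, h1, h2, h3⟩ := h y ⟨⟨Int.fract_nonneg _, (Int.fract_lt_one _).le⟩,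
    Int.fract_nonneg _, (Int.fract_lt_one _).le⟩
  have hm : ∀ z ∈ ball (toComplex x) ρ, z - toComplex k ∈ ball (toComplex y) ρ := by
    intro z hz
    rw [mem_ball, dist_eq_norm] at hz ⊢
    rw [hx, toComplex_add] at hz
    convert hz using 2; abel
  refine ⟨fun z => Φ (z - toComplex k), h1.comp (by fun_prop) hm, fun z hz => h2 _ (hm z hz), ?_⟩
  intro p hp
  have hp' : p - k ∈ ball y ρ := by
    rw [mem_ball, dist_eq_norm] at hp ⊢
    rw [hx] at hp
    convert hp using 2; abel
  have hc : toComplex p - toComplex k = toComplex (p - k) := by simp [toComplex]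
  simp only [hc]
  rw [h3 _ hp', ← hper (p - k) ⌊x.1⌋ ⌊x.2⌋, ← hk, sub_add_cancel]

lemma eqOn_zero_of_real {g : ℂ → ℂ} {U : Set ℂ} (hU : IsOpen U) (hc : IsPreconnected U)
    (hg : DifferentiableOn ℂ g U) {x : ℝ} (hx : (x : ℂ) ∈ U)
    (h0 : ∀ t : ℝ, (t : ℂ) ∈ U → g t = 0) : ∀ z ∈ U, g z = 0 := by
  refine (hg.analyticOnNhd hU).eqOn_zero_of_preconnected_of_frequently_eq_zero hc hx ?_
  have hU' : ∀ᶠ t : ℝ in 𝓝[≠] x, (t : ℂ) ∈ U :=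
    (Complex.continuous_ofReal.continuousAt.eventually (hU.mem_nhds hx)).filter_mono
      nhdsWithin_le_nhds
  have ht : Tendsto (fun t : ℝ => (t : ℂ)) (𝓝[≠] x) (𝓝[≠] (x : ℂ)) := by
    refine tendsto_nhdsWithin_iff.2 ⟨Complex.continuous_ofReal.continuousAt.tendsto.mono_left
      nhdsWithin_le_nhds, ?_⟩
    filter_upwards [self_mem_nhdsWithin] with t ht
    simpa using ht
  exact ht.frequently (hU'.mono fun t ht => h0 t ht).frequently

/-- A holomorphic function on a product domain that vanishes at the real points vanishes. -/
lemma eqOn_zero_of_real_prod {D : ℂ × ℂ → ℂ} {U V : Set ℂ} (hU : IsOpen U) (hV : IsOpen V)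
    (hUc : IsPreconnected U) (hVc : IsPreconnected V) (hD : DifferentiableOn ℂ D (U ×ˢ V))
    {x : ℝ × ℝ} (hx : toComplex x ∈ U ×ˢ V)
    (h0 : ∀ p, toComplex p ∈ U ×ˢ V → D (toComplex p) = 0) : ∀ z ∈ U ×ˢ V, D z = 0 := by
  rintro ⟨z, w⟩ ⟨hz, hw⟩
  -- The one-variable identity theorem is used once per coordinate, reducing first to a real first
  -- coordinate and then to a real second one.
  refine eqOn_zero_of_real (g := fun z => D (z, w)) hU hUc
    (hD.comp (by fun_prop) fun z hz => ⟨hz, hw⟩) (x := x.1) hx.1 (fun t ht => ?_) z hz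
  refine eqOn_zero_of_real (g := fun w => D ((t : ℂ), w)) hV hVc
    (hD.comp (by fun_prop) fun w hw => ⟨ht, hw⟩) (x := x.2) hx.2 (fun u hu => ?_) w hw
  exact h0 (t, u) ⟨ht, hu⟩

/-- Balls of the sup metric are products of discs, so the overlap is a product of convex sets. It
contains the real point `p`, and the identity theorem applies. -/
lemma extensions_agree {Φ Ψ : ℂ × ℂ → ℂ} {f : ℝ × ℝ → ℝ} {x y p : ℝ × ℝ} {ρ : ℝ}
    (hΦ : DifferentiableOn ℂ Φ (ball (toComplex x) ρ))
    (hΨ : DifferentiableOn ℂ Ψ (ball (toComplex y) ρ))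
    (hΦf : ∀ p ∈ ball x ρ, Φ (toComplex p) = f p) (hΨf : ∀ p ∈ ball y ρ, Ψ (toComplex p) = f p)
    (hpx : p ∈ ball x ρ) (hpy : p ∈ ball y ρ) {z : ℂ × ℂ}
    (hzx : z ∈ ball (toComplex x) ρ) (hzy : z ∈ ball (toComplex y) ρ) : Φ z = Ψ z := by
  have hball : ∀ {x q : ℝ × ℝ}, toComplex q ∈ ball (toComplex x) ρ ↔ q ∈ ball x ρ := by
    intro x q; rw [mem_ball, dist_toComplex, mem_ball]
  have hset : (ball (x.1 : ℂ) ρ ∩ ball (y.1 : ℂ) ρ) ×ˢ (ball (x.2 : ℂ) ρ ∩ ball (y.2 : ℂ) ρ) =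
      ball (toComplex x) ρ ∩ ball (toComplex y) ρ := by
    rw [← prod_inter_prod, ball_prod_same, ball_prod_same]; rfl
  have hcv : ∀ a b : ℂ, IsPreconnected (ball a ρ ∩ ball b ρ) := fun a b =>
    ((convex_ball a ρ).inter (convex_ball b ρ)).isPreconnected
  refine sub_eq_zero.1 (eqOn_zero_of_real_prod (D := fun z => Φ z - Ψ z) (x := p)
    (U := ball (x.1 : ℂ) ρ ∩ ball (y.1 : ℂ) ρ) (V := ball (x.2 : ℂ) ρ ∩ ball (y.2 : ℂ) ρ)
    (isOpen_ball.inter isOpen_ball) (isOpen_ball.inter isOpen_ball) (hcv _ _) (hcv _ _)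
    ?_ ?_ ?_ z ?_)
  · rw [hset]
    exact (hΦ.mono inter_subset_left).sub (hΨ.mono inter_subset_right)
  · rw [hset]; exact ⟨hball.2 hpx, hball.2 hpy⟩
  · intro q hq
    rw [hset] at hq
    simp only [hΦf q (hball.1 hq.1), hΨf q (hball.1 hq.2), sub_self]
  · rw [hset]; exact ⟨hzx, hzy⟩

/-- Real-analytic periodic functions extend to bounded holomorphic functions on a strip. -/
lemma exists_strip_extension {f : ℝ × ℝ → ℝ} (hf : AnalyticOnNhd ℝ f univ)
    (hper : ∀ (p : ℝ × ℝ) (m n : ℤ), f (p + ((m : ℝ), (n : ℝ))) = f p) :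
    ∃ ρ > 0, ∃ M, ∃ Φ : ℂ × ℂ → ℂ, DifferentiableOn ℂ Φ (strip ρ) ∧
      (∀ z ∈ strip ρ, ‖Φ z‖ ≤ M) ∧ ∀ p, Φ (toComplex p) = f p := by
  obtain ⟨ρ, hρ, M, h⟩ := exists_uniform_hasExtension hf hper
  choose Φ h1 h2 h3 using h
  have hmem : ∀ z ∈ strip ρ, z ∈ ball (toComplex (rePart z)) ρ := fun z hz => dist_rePart_lt hz
  -- The local extensions are glued by evaluating at `z` the one centred at the real part of `z`;
  -- near `z₀` this coincides with the single extension centred at `rePart z₀`.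
  refine ⟨ρ, hρ, M, fun z => Φ (rePart z) z, ?_, fun z hz => h2 _ z (hmem z hz), ?_⟩
  · intro z₀ hz₀
    have hd : DifferentiableAt ℂ (Φ (rePart z₀)) z₀ :=
      (h1 _).differentiableAt (isOpen_ball.mem_nhds (hmem z₀ hz₀))
    refine (hd.congr_of_eventuallyEq ?_).differentiableWithinAt
    filter_upwards [isOpen_ball.mem_nhds (hmem z₀ hz₀), (isOpen_strip ρ).mem_nhds hz₀]
      with z hz hzs
    refine extensions_agree (h1 _) (h1 _) (h3 _) (h3 _) (p := rePart z) (mem_ball_self hρ) ?_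
      (hmem z hzs) hz
    have := dist_rePart_le (z := z) (w := toComplex (rePart z₀))
    rw [rePart_toComplex] at this
    exact this.trans_lt hz
  · intro p
    simp only [rePart_toComplex]
    exact h3 p p (mem_ball_self hρ)

/-- Bounded holomorphic functions on a strip are Lipschitz on the strip of half the width. -/
lemma lipschitz_of_bounded {Φ : ℂ × ℂ → ℂ} {ρ M : ℝ} (hρ : 0 < ρ)
    (hd : DifferentiableOn ℂ Φ (strip ρ)) (hM : ∀ z ∈ strip ρ, ‖Φ z‖ ≤ M) :
    ∀ z ∈ strip (ρ / 2), ∀ w ∈ strip (ρ / 2), dist (Φ z) (Φ w) ≤ (2 * M + 1) / (ρ / 2) * dist z w := by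
  intro z hz w hw
  have hsub : ball w (ρ / 2) ⊆ strip ρ := by
    intro u hu
    rw [mem_ball, Prod.dist_eq, max_lt_iff, dist_eq_norm, dist_eq_norm] at hu
    have h1 := (Complex.abs_im_le_norm (u.1 - w.1)).trans_lt hu.1
    have h2 := (Complex.abs_im_le_norm (u.2 - w.2)).trans_lt hu.2
    rw [Complex.sub_im] at h1 h2
    have := hw.1; have := hw.2
    constructor
    · have := abs_sub_abs_le_abs_sub u.1.im w.1.im; linarith
    · have := abs_sub_abs_le_abs_sub u.2.im w.2.im; linarith
  have hhalf : strip (ρ / 2) ⊆ strip ρ := fun u hu =>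
    ⟨hu.1.trans (by linarith), hu.2.trans (by linarith)⟩
  have hbd : ∀ u ∈ strip ρ, dist (Φ u) (Φ w) ≤ 2 * M := fun u hu =>
    (dist_le_norm_add_norm _ _).trans (by linarith [hM u hu, hM w (hhalf hw)])
  have hM0 : 0 ≤ M := (norm_nonneg _).trans (hM w (hhalf hw))
  -- Nearby points are handled by the Schwarz lemma, distant ones by the crude bound `2 * M`. The `+
  -- 1` keeps the constant positive when `M = 0`.
  by_cases hzw : z ∈ ball w (ρ / 2)
  · exact Complex.dist_le_div_mul_dist_of_mapsTo_ball (hd.mono hsub)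
      (fun u hu => mem_closedBall.2 ((hbd u (hsub hu)).trans (by linarith))) hzw
  · have hge : ρ / 2 ≤ dist z w := not_lt.1 hzw
    refine (hbd z (hhalf hz)).trans ?_
    rw [div_mul_eq_mul_div, le_div_iff₀ (by positivity)]
    nlinarith

/-- A real-analytic function that is periodic up to a linear function extends to a Lipschitz
holomorphic function on a strip. -/
lemma exists_lipschitz_extension {f : ℝ × ℝ → ℝ} (hf : AnalyticOnNhd ℝ f univ) {a b : ℝ}
    (h1 : ∀ p : ℝ × ℝ, f (p + (1, 0)) = f p + a) (h2 : ∀ p : ℝ × ℝ, f (p + (0, 1)) = f p + b) :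
    ∃ ρ > 0, ∃ L > 0, ∃ Φ : ℂ × ℂ → ℂ, DifferentiableOn ℂ Φ (strip ρ) ∧
      (∀ z ∈ strip ρ, ∀ w ∈ strip ρ, dist (Φ z) (Φ w) ≤ L * dist z w) ∧
      ∀ p, Φ (toComplex p) = f p := by
  -- Lifts of maps of arbitrary homotopy class are periodic only after subtraction of their linear
  -- part.
  set g : ℝ × ℝ → ℝ := fun p => f p - (a * p.1 + b * p.2) with hg
  have hga : AnalyticOnNhd ℝ g univ := by
    exact hf.sub fun x _ => (analyticAt_const.mul analyticAt_fst).add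
      (analyticAt_const.mul analyticAt_snd)
  have hg1 : ∀ p : ℝ × ℝ, g (p + (1, 0)) = g p := by
    intro p; simp [hg, h1]; ring
  have hg2 : ∀ p : ℝ × ℝ, g (p + (0, 1)) = g p := by
    intro p; simp [hg, h2]; ring
  have hper : ∀ (p : ℝ × ℝ) (m n : ℤ), g (p + ((m : ℝ), (n : ℝ))) = g p := by
    intro p m n
    have e1 : Function.Periodic g ((1 : ℝ), (0 : ℝ)) := hg1
    have e2 : Function.Periodic g ((0 : ℝ), (1 : ℝ)) := hg2
    have e3 := (e1.zsmul m).add_period (e2.zsmul n) p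
    simpa using e3
  obtain ⟨ρ, hρ, M, Φ, hd, hM, hΦ⟩ := exists_strip_extension hga hper
  have hlip := lipschitz_of_bounded hρ hd hM
  have hM0 : 0 ≤ M := (norm_nonneg _).trans (hM _ (toComplex_mem_strip hρ 0))
  refine ⟨ρ / 2, by positivity, (2 * M + 1) / (ρ / 2) + (|a| + |b|), by positivity,
    fun z => Φ z + ((a : ℂ) * z.1 + b * z.2), ?_, ?_, ?_⟩
  · refine (hd.mono fun u hu => ⟨hu.1.trans (by linarith), hu.2.trans (by linarith)⟩).add ?_
    fun_prop
  · intro z hz w hw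
    refine (dist_add_add_le _ _ _ _).trans ?_
    rw [add_mul]
    refine add_le_add (hlip z hz w hw) ?_
    rw [dist_eq_norm]
    have : (a : ℂ) * z.1 + b * z.2 - (a * w.1 + b * w.2) = a * (z.1 - w.1) + b * (z.2 - w.2) := by
      ring
    rw [this, add_mul]
    refine (norm_add_le _ _).trans (add_le_add ?_ ?_)
    · rw [norm_mul, Complex.norm_real, Real.norm_eq_abs, ← dist_eq_norm]
      gcongr; exact le_max_left _ _
    · rw [norm_mul, Complex.norm_real, Real.norm_eq_abs, ← dist_eq_norm]
      gcongr; exact le_max_right _ _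
  · intro p
    simp only [hΦ, hg]
    simp [toComplex]


/-! ### Lifts of torus maps -/

lemma proj_add (p q : ℝ × ℝ) : proj (p + q) = proj p + proj q := by
  simp [proj]

lemma proj_sub (p q : ℝ × ℝ) : proj (p - q) = proj p - proj q := by
  simp [proj]

lemma proj_int (m n : ℤ) : proj ((m : ℝ), (n : ℝ)) = 0 := by
  have h : ∀ k : ℤ, ((k : ℝ) : UnitAddCircle) = 0 := fun k =>
    (AddCircle.coe_eq_zero_iff 1).2 ⟨k, by simp⟩
  simp [proj, h]

lemma exists_int_of_coe_eq_zero {g : ℝ × ℝ → ℝ} (hg : Continuous g)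
    (h : ∀ p, ((g p : ℝ) : UnitAddCircle) = 0) : ∃ n : ℤ, ∀ p, g p = n := by
  have hinteger : ∀ p, ∃ n : ℤ, (n : ℝ) = g p := fun p => by
    obtain ⟨n, hn⟩ := (AddCircle.coe_eq_zero_iff 1).1 (h p)
    exact ⟨n, by simpa using hn⟩
  choose N hN using hinteger
  have hNc : Continuous N := by
    rw [Int.isClosedEmbedding_coe_real.isInducing.continuous_iff]
    exact hg.congr fun p => (hN p).symm
  refine ⟨N 0, fun p => ?_⟩
  rw [← hN p, PreconnectedSpace.constant inferInstance hNc (x := p) (y := 0)]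

lemma exists_int_of_proj_eq_zero {g : ℝ × ℝ → ℝ × ℝ} (hg : Continuous g)
    (h : ∀ p, proj (g p) = 0) : ∃ m n : ℤ, ∀ p, g p = ((m : ℝ), (n : ℝ)) := by
  obtain ⟨m, hm⟩ := exists_int_of_coe_eq_zero (g := fun p => (g p).1) (by fun_prop)
    fun p => congrArg Prod.fst (h p)
  obtain ⟨n, hn⟩ := exists_int_of_coe_eq_zero (g := fun p => (g p).2) (by fun_prop)
    fun p => congrArg Prod.snd (h p)
  exact ⟨m, n, fun p => Prod.ext (hm p) (hn p)⟩

lemma lift_add_int {F : Torus → Torus} {f : ℝ × ℝ → ℝ × ℝ} (hf : Continuous f)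
    (hF : ∀ p, F (proj p) = proj (f p)) (m n : ℤ) :
    ∃ m' n' : ℤ, ∀ p, f (p + ((m : ℝ), (n : ℝ))) = f p + ((m' : ℝ), (n' : ℝ)) := by
  obtain ⟨m', n', h⟩ := exists_int_of_proj_eq_zero
    (g := fun p => f (p + ((m : ℝ), (n : ℝ))) - f p) (by fun_prop) fun p => by
      rw [proj_sub, ← hF, ← hF, proj_add, proj_int, add_zero, sub_self]
  exact ⟨m', n', fun p => by rw [← h p]; abel⟩

/-- A lift of a real-analytic torus map, together with its holomorphic extension. -/
structure ExtendedLift (F : Torus → Torus) where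
  lift : ℝ × ℝ → ℝ × ℝ
  lift_proj : ∀ p, F (proj p) = proj (lift p)
  continuous_lift : Continuous lift
  ext : ℂ × ℂ → ℂ × ℂ
  width : ℝ
  width_pos : 0 < width
  lip : ℝ
  lip_pos : 0 < lip
  differentiableOn : DifferentiableOn ℂ ext (strip width)
  lipschitz : ∀ z ∈ strip width, ∀ w ∈ strip width, dist (ext z) (ext w) ≤ lip * dist z w
  ext_toComplex : ∀ p, ext (toComplex p) = toComplex (lift p)

lemma strip_mono {r s : ℝ} (h : r ≤ s) : strip r ⊆ strip s := fun _ hz =>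
  ⟨hz.1.trans_le h, hz.2.trans_le h⟩

lemma IsRealAnalytic.nonempty_extendedLift {F : Torus → Torus} (hF : IsRealAnalytic F) :
    Nonempty (ExtendedLift F) := by
  obtain ⟨f, hf, hlift⟩ := hF
  have hc : Continuous f := continuousOn_univ.1 hf.continuousOn
  obtain ⟨a₁, a₂, ha⟩ := lift_add_int hc hlift 1 0
  obtain ⟨b₁, b₂, hb⟩ := lift_add_int hc hlift 0 1
  have h1 : AnalyticOnNhd ℝ (fun p => (f p).1) univ := fun p hp =>
    analyticAt_fst.comp (hf p hp)
  have h2 : AnalyticOnNhd ℝ (fun p => (f p).2) univ := fun p hp =>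
    analyticAt_snd.comp (hf p hp)
  obtain ⟨ρ, hρ, L, hL, Φ, hd, hlip, hΦ⟩ := exists_lipschitz_extension h1 (a := a₁) (b := b₁)
    (fun p => by simpa using congrArg Prod.fst (ha p))
    (fun p => by simpa using congrArg Prod.fst (hb p))
  obtain ⟨ρ', hρ', L', hL', Φ', hd', hlip', hΦ'⟩ :=
    exists_lipschitz_extension h2 (a := a₂) (b := b₂)
    (fun p => by simpa using congrArg Prod.snd (ha p))
    (fun p => by simpa using congrArg Prod.snd (hb p))
  have s1 := strip_mono (min_le_left ρ ρ')
  have s2 := strip_mono (min_le_right ρ ρ')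
  refine ⟨⟨f, hlift, hc, fun z => (Φ z, Φ' z), min ρ ρ', lt_min hρ hρ', max L L',
    lt_max_of_lt_left hL, (hd.mono s1).prodMk (hd'.mono s2), ?_, ?_⟩⟩
  · intro z hz w hw
    refine max_le ((hlip z (s1 hz) w (s1 hw)).trans ?_) ((hlip' z (s2 hz) w (s2 hw)).trans ?_)
    · gcongr; exact le_max_left _ _
    · gcongr; exact le_max_right _ _
  · intro p; simp only [hΦ, hΦ']; rfl

lemma mem_strip_of_dist_lt {z : ℂ × ℂ} {q : ℝ × ℝ} {η : ℝ} (h : dist z (toComplex q) < η) :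
    z ∈ strip η := by
  rw [Prod.dist_eq, max_lt_iff, dist_eq_norm, dist_eq_norm] at h
  have h1 := (Complex.abs_im_le_norm (z.1 - (toComplex q).1)).trans_lt h.1
  have h2 := (Complex.abs_im_le_norm (z.2 - (toComplex q).2)).trans_lt h.2
  simp only [toComplex, Complex.sub_im, Complex.ofReal_im, sub_zero] at h1 h2
  exact ⟨h1, h2⟩

/-! ### Displacements on strips -/

/-- The holomorphic function on the strip given by an element of `𝒟_r` (zero off the strip). -/
def dispExt {r : ℝ} {hr : 0 < r} (φ : DispSpace hr) (z : ℂ × ℂ) : ℂ × ℂ :=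
  open Classical in if h : z ∈ strip r then (φ.1.1 ⟨z, h⟩, φ.2.1 ⟨z, h⟩) else 0

/-- The real displacement function given by an element of `𝒟_r`. -/
def dispReal {r : ℝ} {hr : 0 < r} (φ : DispSpace hr) (p : ℝ × ℝ) : ℝ × ℝ :=
  ((φ.1.1 (realPoint hr p)).re, (φ.2.1 (realPoint hr p)).re)

section Disp

variable {r : ℝ} {hr : 0 < r}

lemma isDisplacement_iff {φ : DispSpace hr} {F : Diff} :
    IsDisplacement hr φ F ↔ ∀ p, F.toHomeomorph (proj p) = proj (p + dispReal φ p) := Iff.rfl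

lemma dispExt_of_mem (φ : DispSpace hr) {z : ℂ × ℂ} (h : z ∈ strip r) :
    dispExt φ z = (φ.1.1 ⟨z, h⟩, φ.2.1 ⟨z, h⟩) := by
  simp [dispExt, h]

lemma dispExt_toComplex (φ : DispSpace hr) (p : ℝ × ℝ) :
    dispExt φ (toComplex p) = toComplex (dispReal φ p) := by
  obtain ⟨⟨φ₁, -, f₁, -, h₁⟩, ⟨φ₂, -, f₂, -, h₂⟩⟩ := φ
  rw [dispExt_of_mem _ (toComplex_mem_strip hr p)]
  change (φ₁ (realPoint hr p), φ₂ (realPoint hr p)) =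
    ((((φ₁ (realPoint hr p)).re : ℝ) : ℂ), (((φ₂ (realPoint hr p)).re : ℝ) : ℂ))
  simp [h₁, h₂]

lemma dispReal_add_int (φ : DispSpace hr) (p : ℝ × ℝ) (m n : ℤ) :
    dispReal φ (p + ((m : ℝ), (n : ℝ))) = dispReal φ p := by
  obtain ⟨⟨φ₁, -, f₁, hp₁, h₁⟩, ⟨φ₂, -, f₂, hp₂, h₂⟩⟩ := φ
  have key : ∀ f : ℝ × ℝ → ℝ, (∀ x y, f (x + 1, y) = f (x, y) ∧ f (x, y + 1) = f (x, y)) →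
      f (p + ((m : ℝ), (n : ℝ))) = f p := by
    intro f hf
    have e1 : Function.Periodic f ((1 : ℝ), (0 : ℝ)) := fun q => by
      have := (hf q.1 q.2).1
      rwa [show q + ((1 : ℝ), (0 : ℝ)) = (q.1 + 1, q.2) by ext <;> simp]
    have e2 : Function.Periodic f ((0 : ℝ), (1 : ℝ)) := fun q => by
      have := (hf q.1 q.2).2
      rwa [show q + ((0 : ℝ), (1 : ℝ)) = (q.1, q.2 + 1) by ext <;> simp]
    simpa using (e1.zsmul m).add_period (e2.zsmul n) p
  simp [dispReal, h₁, h₂, key f₁ hp₁, key f₂ hp₂]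

lemma dispExt_differentiableOn (φ : DispSpace hr) : DifferentiableOn ℂ (dispExt φ) (strip r) := by
  obtain ⟨Φ₁, hd₁, h₁⟩ := φ.1.2.1
  obtain ⟨Φ₂, hd₂, h₂⟩ := φ.2.2.1
  refine (hd₁.prodMk hd₂).congr fun z hz => ?_
  rw [dispExt_of_mem φ hz, ← h₁ ⟨z, hz⟩, ← h₂ ⟨z, hz⟩]

lemma dist_dispExt_le (φ ψ : DispSpace hr) {z : ℂ × ℂ} (hz : z ∈ strip r) :
    dist (dispExt φ z) (dispExt ψ z) ≤ dist φ ψ := by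
  rw [dispExt_of_mem φ hz, dispExt_of_mem ψ hz]
  exact max_le_max (BoundedContinuousFunction.dist_coe_le_dist _)
    (BoundedContinuousFunction.dist_coe_le_dist _)

lemma dist_le_of_dispExt {φ ψ : DispSpace hr} {C : ℝ} (hC : 0 ≤ C)
    (h : ∀ z ∈ strip r, dist (dispExt φ z) (dispExt ψ z) ≤ C) : dist φ ψ ≤ C := by
  refine max_le ?_ ?_ <;>
  · refine (BoundedContinuousFunction.dist_le hC).2 fun z => ?_
    have := h z z.2
    rw [dispExt_of_mem φ z.2, dispExt_of_mem ψ z.2] at this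
    first
    | exact (le_max_left _ _).trans this
    | exact (le_max_right _ _).trans this

lemma norm_dispExt_le (φ : DispSpace hr) {z : ℂ × ℂ} (hz : z ∈ strip r) :
    ‖dispExt φ z‖ ≤ max ‖φ.1.1‖ ‖φ.2.1‖ := by
  rw [dispExt_of_mem φ hz]
  exact max_le_max (BoundedContinuousFunction.norm_coe_le_norm _ _)
    (BoundedContinuousFunction.norm_coe_le_norm _ _)

lemma exists_dispExt_lipschitz (φ : DispSpace hr) : ∃ L > 0, ∀ z ∈ strip (r / 2),
    ∀ w ∈ strip (r / 2), dist (dispExt φ z) (dispExt φ w) ≤ L * dist z w := by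
  set M := max ‖φ.1.1‖ ‖φ.2.1‖ with hM
  have hM0 : 0 ≤ M := (norm_nonneg _).trans (le_max_left _ _)
  refine ⟨(2 * M + 1) / (r / 2), by positivity, fun z hz w hw => max_le ?_ ?_⟩
  · exact lipschitz_of_bounded (Φ := fun z => (dispExt φ z).1) hr
      (dispExt_differentiableOn φ).fst
      (fun z hz => (norm_fst_le _).trans (norm_dispExt_le φ hz)) z hz w hw
  · exact lipschitz_of_bounded (Φ := fun z => (dispExt φ z).2) hr
      (dispExt_differentiableOn φ).snd
      (fun z hz => (norm_snd_le _).trans (norm_dispExt_le φ hz)) z hz w hw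

lemma exists_dispExt_eq (hr : 0 < r) {Ψ : ℂ × ℂ → ℂ × ℂ} (hd : DifferentiableOn ℂ Ψ (strip r))
    {M : ℝ} (hM : ∀ z ∈ strip r, ‖Ψ z‖ ≤ M) {f : ℝ × ℝ → ℝ × ℝ}
    (hf : ∀ p, Ψ (toComplex p) = toComplex (f p))
    (hper : ∀ p (m n : ℤ), f (p + ((m : ℝ), (n : ℝ))) = f p) :
    ∃ φ : DispSpace hr, (∀ z ∈ strip r, dispExt φ z = Ψ z) ∧ dispReal φ = f := by
  have hcont : Continuous fun z : strip r => Ψ z :=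
    continuousOn_iff_continuous_domRestrict.1 hd.continuousOn
  set φ₁ : strip r →ᵇ ℂ := BoundedContinuousFunction.ofNormedAddCommGroup
    (fun z => (Ψ z).1) (continuous_fst.comp hcont) M
    (fun z => (norm_fst_le _).trans (hM z z.2)) with hφ₁
  set φ₂ : strip r →ᵇ ℂ := BoundedContinuousFunction.ofNormedAddCommGroup
    (fun z => (Ψ z).2) (continuous_snd.comp hcont) M
    (fun z => (norm_snd_le _).trans (hM z z.2)) with hφ₂
  have hp1 : ∀ x y, f (x + 1, y) = f (x, y) := fun x y => by simpa using hper (x, y) 1 0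
  have hp2 : ∀ x y, f (x, y + 1) = f (x, y) := fun x y => by simpa using hper (x, y) 0 1
  have m1 : φ₁ ∈ periodicAnalytic hr := by
    refine ⟨⟨fun z => (Ψ z).1, hd.fst, fun z => rfl⟩, fun p => (f p).1, fun x y => ?_, fun p => ?_⟩
    · simp only [hp1, hp2, and_self]
    · exact congrArg Prod.fst (hf p)
  have m2 : φ₂ ∈ periodicAnalytic hr := by
    refine ⟨⟨fun z => (Ψ z).2, hd.snd, fun z => rfl⟩, fun p => (f p).2, fun x y => ?_, fun p => ?_⟩
    · simp only [hp1, hp2, and_self]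
    · exact congrArg Prod.snd (hf p)
  have hext : ∀ z ∈ strip r, dispExt ((⟨φ₁, m1⟩, ⟨φ₂, m2⟩) : DispSpace hr) z = Ψ z := by
    intro z hz
    rw [dispExt_of_mem _ hz]
    rfl
  refine ⟨(⟨φ₁, m1⟩, ⟨φ₂, m2⟩), hext, funext fun p => ?_⟩
  have := (dispExt_toComplex ((⟨φ₁, m1⟩, ⟨φ₂, m2⟩) : DispSpace hr) p).symm.trans
    ((hext _ (toComplex_mem_strip hr p)).trans (hf p))
  simpa using congrArg rePart this

end Disp

/-! ### Conjugation and the inductive limit topology -/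

lemma IsRealAnalytic.comp {F G : Torus → Torus} (hF : IsRealAnalytic F) (hG : IsRealAnalytic G) :
    IsRealAnalytic (F ∘ G) := by
  obtain ⟨f, hf, hfl⟩ := hF
  obtain ⟨g, hg, hgl⟩ := hG
  exact ⟨f ∘ g, hf.comp hg fun _ _ => mem_univ _, fun p => by simp [hgl, hfl]⟩

lemma Diff.ext_toHomeomorph {F G : Diff} (h : ∀ p, F.toHomeomorph p = G.toHomeomorph p) :
    F = G := by
  obtain ⟨⟨F, _, _⟩, _⟩ := F
  obtain ⟨⟨G, _, _⟩, _⟩ := G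
  obtain rfl : F = G := Homeomorph.ext h
  rfl

/-- Conjugation of `F` by `T`. -/
def conjDiff (T : AnalyticDiffeo) (F : Diff) : Diff where
  toHomeomorph := (T.toHomeomorph.trans F.toHomeomorph).trans T.toHomeomorph.symm
  analytic := T.analytic_symm.comp (F.analytic.comp T.analytic)
  analytic_symm := T.analytic_symm.comp (F.analytic_symm.comp T.analytic)
  homotopic_id := by
    have h := ((ContinuousMap.Homotopic.refl (T.toHomeomorph.symm : C(Torus, Torus))).comp
      (F.homotopic_id.comp (ContinuousMap.Homotopic.refl (T.toHomeomorph : C(Torus, Torus)))))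
    have e : (T.toHomeomorph.symm : C(Torus, Torus)).comp
        ((ContinuousMap.id Torus).comp (T.toHomeomorph : C(Torus, Torus))) =
        ContinuousMap.id Torus :=
      ContinuousMap.ext fun p => T.toHomeomorph.symm_apply_apply p
    rw [e] at h
    exact h

lemma conjDiff_apply (T : AnalyticDiffeo) (F : Diff) (p : Torus) :
    (conjDiff T F).toHomeomorph p =
      T.toHomeomorph.symm (F.toHomeomorph (T.toHomeomorph p)) := rfl

/-- With lifts `t` of `T` and `s` of its inverse, the conjugate has displacement `s(t z + φ(t z)) -
s(t z)`. On a narrow enough strip this is defined for all `φ` near `φ₀`, and it is Lipschitz in `φ`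
because `s` is. -/
lemma exists_conj_displacement (T : AnalyticDiffeo) {r : ℝ} (hr : 0 < r) (φ₀ : DispSpace hr) :
    ∃ (r' : ℝ) (hr' : 0 < r'), ∃ L > 0, ∃ ε > 0, ∃ Δ : DispSpace hr → DispSpace hr',
      ∀ φ, dist φ φ₀ < ε → dist (Δ φ) (Δ φ₀) ≤ L * dist φ φ₀ ∧
        ∀ F, IsDisplacement hr φ F → IsDisplacement hr' (Δ φ) (conjDiff T F) := by
  obtain ⟨t⟩ := T.analytic.nonempty_extendedLift
  obtain ⟨s⟩ := T.analytic_symm.nonempty_extendedLift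
  obtain ⟨Lφ, hLφ, hlip⟩ := exists_dispExt_lipschitz φ₀
  have ht0 := t.width_pos
  have hs0 := s.width_pos
  have htL := t.lip_pos
  set η := min (r / 2) (s.width / 2) with hη
  have hη0 : 0 < η := lt_min (by positivity) (by positivity)
  -- On this strip `t z + φ₀(t z)` lies within `η ≤ s.width / 2` of a real point; the other half of
  -- `s.width` absorbs the difference between `φ` and `φ₀`.
  set r' := min t.width (η / ((1 + Lφ) * t.lip)) with hr'
  have hrpos : 0 < r' := lt_min ht0 (by positivity)
  have hsum : (1 + Lφ) * (t.lip * r') ≤ η := by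
    have : r' ≤ η / ((1 + Lφ) * t.lip) := min_le_right _ _
    rw [le_div_iff₀ (by positivity)] at this
    linarith
  have htr : t.lip * r' ≤ η := by
    have : 0 < t.lip * r' := by positivity
    nlinarith
  have hzt : ∀ z ∈ strip r', z ∈ strip t.width := strip_mono (min_le_left _ _)
  have hdist : ∀ z ∈ strip r',
      dist (t.ext z) (toComplex (t.lift (rePart z))) < t.lip * r' := by
    intro z hz
    rw [← t.ext_toComplex]
    refine (t.lipschitz z (hzt z hz) _ (toComplex_mem_strip ht0 _)).trans_lt ?_
    exact mul_lt_mul_of_pos_left (dist_rePart_lt hz) htL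
  have hη1 : η ≤ r / 2 := min_le_left _ _
  have hη2 : η ≤ s.width / 2 := min_le_right _ _
  have htη : ∀ z ∈ strip r', t.ext z ∈ strip η := fun z hz =>
    mem_strip_of_dist_lt ((hdist z hz).trans_le htr)
  have htr2 : ∀ z ∈ strip r', t.ext z ∈ strip (r / 2) := fun z hz => strip_mono hη1 (htη z hz)
  have htr1 : ∀ z ∈ strip r', t.ext z ∈ strip r := fun z hz =>
    strip_mono (by linarith) (htr2 z hz)
  have hts : ∀ z ∈ strip r', t.ext z ∈ strip s.width := fun z hz =>
    strip_mono (by linarith) (htη z hz)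
  have hmem : ∀ φ : DispSpace hr, dist φ φ₀ < s.width / 2 → ∀ z ∈ strip r',
      t.ext z + dispExt φ (t.ext z) ∈ strip s.width := by
    intro φ hφ z hz
    set q := t.lift (rePart z) with hq
    refine mem_strip_of_dist_lt (q := q + dispReal φ₀ q) ?_
    rw [toComplex_add, ← dispExt_toComplex]
    have h1 := hdist z hz
    have h2 := dist_dispExt_le φ φ₀ (htr1 z hz)
    have h3 := hlip _ (htr2 z hz) (toComplex q) (toComplex_mem_strip (by positivity) q)
    have h4 := dist_add_add_le (t.ext z) (dispExt φ (t.ext z)) (toComplex q)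
      (dispExt φ₀ (toComplex q))
    have h5 := dist_triangle (dispExt φ (t.ext z)) (dispExt φ₀ (t.ext z))
      (dispExt φ₀ (toComplex q))
    have h6 : Lφ * dist (t.ext z) (toComplex q) ≤ Lφ * (t.lip * r') := by gcongr
    linarith
  -- At real points `s(t p)` and `p` have the same projection, so `s(t z)` may be subtracted in
  -- place of `z`; boundedness then follows from the Lipschitz bound for `s`.
  have hex : ∀ φ : DispSpace hr, dist φ φ₀ < s.width / 2 → ∃ δ : DispSpace hrpos,
      (∀ z ∈ strip r', dispExt δ z = s.ext (t.ext z + dispExt φ (t.ext z)) - s.ext (t.ext z)) ∧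
      dispReal δ = fun p => s.lift (t.lift p + dispReal φ (t.lift p)) - s.lift (t.lift p) := by
    intro φ hφ
    have dt : DifferentiableOn ℂ t.ext (strip r') :=
      t.differentiableOn.mono (strip_mono (min_le_left _ _))
    refine exists_dispExt_eq hrpos (M := s.lip * max ‖φ.1.1‖ ‖φ.2.1‖) ?_ ?_ ?_ ?_
    · exact (s.differentiableOn.comp (dt.add ((dispExt_differentiableOn φ).comp dt htr1))
        (hmem φ hφ)).sub (s.differentiableOn.comp dt hts)
    · intro z hz
      rw [← dist_eq_norm]
      refine (s.lipschitz _ (hmem φ hφ z hz) _ (hts z hz)).trans ?_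
      rw [dist_eq_norm, add_sub_cancel_left]
      gcongr
      · exact s.lip_pos.le
      · exact norm_dispExt_le φ (htr1 z hz)
    · intro p
      rw [t.ext_toComplex, dispExt_toComplex, ← toComplex_add, s.ext_toComplex, s.ext_toComplex]
      simp [toComplex]
    · intro p m n
      obtain ⟨m', n', h⟩ := lift_add_int t.continuous_lift t.lift_proj m n
      obtain ⟨m'', n'', h'⟩ := lift_add_int s.continuous_lift s.lift_proj m' n'
      rw [h, dispReal_add_int, add_right_comm, h', h', add_sub_add_right_eq_sub]
  have h0 : dist φ₀ φ₀ < s.width / 2 := by rw [dist_self]; positivity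
  have : Nonempty (DispSpace hrpos) := ⟨(hex φ₀ h0).choose⟩
  choose! Δ hΔ hΔ' using hex
  refine ⟨r', hrpos, s.lip, s.lip_pos, s.width / 2, by positivity, Δ, fun φ hφ => ⟨?_, ?_⟩⟩
  · refine dist_le_of_dispExt (mul_nonneg s.lip_pos.le dist_nonneg) fun z hz => ?_
    rw [hΔ φ hφ z hz, hΔ φ₀ h0 z hz, dist_sub_right]
    refine (s.lipschitz _ (hmem φ hφ z hz) _ (hmem φ₀ h0 z hz)).trans ?_
    rw [dist_add_left]
    exact mul_le_mul_of_nonneg_left (dist_dispExt_le φ φ₀ (htr1 z hz)) s.lip_pos.le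
  · intro F hF
    rw [isDisplacement_iff] at hF ⊢
    intro p
    have hst : proj (s.lift (t.lift p)) = proj p := by
      rw [← s.lift_proj, ← t.lift_proj, Homeomorph.symm_apply_apply]
    rw [conjDiff_apply, t.lift_proj, hF, s.lift_proj, hΔ' φ hφ, proj_add, proj_sub, hst]
    abel

/-- Conjugation by an analytic diffeomorphism is continuous for the inductive limit topology. -/
lemma continuous_conjDiff (T : AnalyticDiffeo) : Continuous (conjDiff T) := by
  refine ⟨fun O hO r hr => ?_⟩
  -- Elements of `𝒟_r` that represent no diffeomorphism belong to this set vacuously, so only the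
  -- representing ones near `φ₀` need a check.
  refine ⟨interior {φ | ∀ F, IsDisplacement hr φ F → conjDiff T F ∈ O}, isOpen_interior, ?_⟩
  intro φ₀ F hF
  refine ⟨fun h => interior_subset h F hF, fun h => ?_⟩
  obtain ⟨r', hr', L, hL, ε, hε, Δ, hΔ⟩ := exists_conj_displacement T hr φ₀
  obtain ⟨U, hU, hUO⟩ := hO r' hr'
  have h0 := (hΔ φ₀ (by rwa [dist_self])).2 F hF
  obtain ⟨κ, hκ, hball⟩ := Metric.isOpen_iff.1 hU _ ((hUO _ _ h0).2 h)
  rw [mem_interior_iff_mem_nhds]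
  refine Filter.mem_of_superset (ball_mem_nhds φ₀ (lt_min hε (div_pos hκ hL))) ?_
  intro φ hφ G hG
  rw [mem_ball, lt_min_iff] at hφ
  obtain ⟨h1, h2⟩ := hΔ φ hφ.1
  refine (hUO _ _ (h2 G hG)).1 (hball ?_)
  refine h1.trans_lt ?_
  rw [mul_comm]
  exact (lt_div_iff₀ hL).1 hφ.2


/-! ### Analytic skew products -/

/-- The skew product `(x, y) ↦ (x + α, y + ψ(x))`. -/
def skewHomeomorph (α : ℝ) (ψ : C(UnitAddCircle, ℝ)) : Torus ≃ₜ Torus where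
  toFun p := (p.1 + (α : UnitAddCircle), p.2 + ((ψ p.1 : ℝ) : UnitAddCircle))
  invFun p := (p.1 - (α : UnitAddCircle),
    p.2 - ((ψ (p.1 - (α : UnitAddCircle)) : ℝ) : UnitAddCircle))
  left_inv p := by simp
  right_inv p := by simp
  continuous_toFun := by
    have : Continuous fun p : Torus => ((ψ p.1 : ℝ) : UnitAddCircle) :=
      (AddCircle.continuous_mk' 1).comp (ψ.continuous.comp continuous_fst)
    fun_prop
  continuous_invFun := by
    have : Continuous fun p : Torus => ((ψ (p.1 - (α : UnitAddCircle)) : ℝ) : UnitAddCircle) :=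
      (AddCircle.continuous_mk' 1).comp (ψ.continuous.comp (by fun_prop))
    fun_prop

lemma skewHomeomorph_apply (α : ℝ) (ψ : C(UnitAddCircle, ℝ)) (p : Torus) :
    skewHomeomorph α ψ p = (p.1 + (α : UnitAddCircle), p.2 + ((ψ p.1 : ℝ) : UnitAddCircle)) := rfl

lemma skewHomeomorph_symm_apply (α : ℝ) (ψ : C(UnitAddCircle, ℝ)) (p : Torus) :
    (skewHomeomorph α ψ).symm p = (p.1 - (α : UnitAddCircle),
      p.2 - ((ψ (p.1 - (α : UnitAddCircle)) : ℝ) : UnitAddCircle)) := rfl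

/-- Analytic skew products as elements of `Diff`. -/
def skewDiff (α : ℝ) (ψ : C(UnitAddCircle, ℝ))
    (hψ : AnalyticOnNhd ℝ (fun x : ℝ => ψ (x : UnitAddCircle)) univ) : Diff where
  toHomeomorph := skewHomeomorph α ψ
  analytic := by
    refine ⟨fun p => (p.1 + α, p.2 + ψ (p.1 : UnitAddCircle)), fun p _ => ?_, fun p => ?_⟩
    · have h : AnalyticAt ℝ (fun p : ℝ × ℝ => ψ (p.1 : UnitAddCircle)) p :=
        AnalyticAt.fun_comp (g := fun x : ℝ => ψ (x : UnitAddCircle)) (hψ p.1 (mem_univ _))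
          analyticAt_fst
      exact (analyticAt_fst.add analyticAt_const).prod (analyticAt_snd.add h)
    · simp [skewHomeomorph_apply, proj]
  analytic_symm := by
    refine ⟨fun p => (p.1 - α, p.2 - ψ ((p.1 - α : ℝ) : UnitAddCircle)), fun p _ => ?_,
      fun p => ?_⟩
    · have h : AnalyticAt ℝ (fun p : ℝ × ℝ => ψ ((p.1 - α : ℝ) : UnitAddCircle)) p :=
        AnalyticAt.fun_comp (f := fun p : ℝ × ℝ => p.1 - α) (hψ (p.1 - α) (mem_univ _))
          (analyticAt_fst.sub analyticAt_const)
      exact (analyticAt_fst.sub analyticAt_const).prod (analyticAt_snd.sub h)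
    · simp [skewHomeomorph_symm_apply, proj]
  homotopic_id := by
    have hc : Continuous fun q : unitInterval × Torus =>
        (((q.1 : ℝ) * ψ q.2.1 : ℝ) : UnitAddCircle) :=
      (AddCircle.continuous_mk' 1).comp (by fun_prop)
    have hc' : Continuous fun q : unitInterval × Torus => (((q.1 : ℝ) * α : ℝ) : UnitAddCircle) :=
      (AddCircle.continuous_mk' 1).comp (by fun_prop)
    refine ContinuousMap.Homotopic.symm ⟨⟨⟨fun q => (q.2.1 + (((q.1 : ℝ) * α : ℝ) : UnitAddCircle),
      q.2.2 + (((q.1 : ℝ) * ψ q.2.1 : ℝ) : UnitAddCircle)), by fun_prop⟩, fun p => ?_, fun p => ?_⟩⟩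
    · simp
    · simp [skewHomeomorph_apply]

lemma skewHomeomorph_measurePreserving (α : ℝ) (ψ : C(UnitAddCircle, ℝ)) :
    MeasurePreserving (skewHomeomorph α ψ) volume volume := by
  have hc : Continuous fun p : Torus => ((ψ p.1 : ℝ) : UnitAddCircle) :=
    (AddCircle.continuous_mk' 1).comp (ψ.continuous.comp continuous_fst)
  have hm : Measurable fun p : Torus => p.2 + ((ψ p.1 : ℝ) : UnitAddCircle) := by
    fun_prop
  refine MeasurePreserving.skew_product (f := fun x : UnitAddCircle => x + (α : UnitAddCircle))
    (g := fun x y => y + ((ψ x : ℝ) : UnitAddCircle))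
    (measurePreserving_add_right volume _) hm ?_
  exact Eventually.of_forall fun x => (measurePreserving_add_right volume _).map_eq

/-- Skew products with coboundaries are conjugate to the rotation. -/
lemma skewDiff_mem_conjugates {α : ℝ} {ψ Φ : C(UnitAddCircle, ℝ)}
    (hψ : AnalyticOnNhd ℝ (fun x : ℝ => ψ (x : UnitAddCircle)) univ)
    (hΦ : AnalyticOnNhd ℝ (fun x : ℝ => Φ (x : UnitAddCircle)) univ)
    (h : ∀ x, ψ x = Φ (x + (α : UnitAddCircle)) - Φ x) : skewDiff α ψ hψ ∈ conjugates α := by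
  have hΦ' : AnalyticOnNhd ℝ (fun x : ℝ => (-Φ) (x : UnitAddCircle)) univ := hΦ.neg
  -- The conjugacy is `T (x, y) = (x, y - Φ(x))`.
  refine ⟨(skewDiff 0 (-Φ) hΦ').toAnalyticDiffeo, skewHomeomorph_measurePreserving 0 (-Φ), ?_⟩
  intro p
  change skewHomeomorph α ψ p = (skewHomeomorph 0 (-Φ)).symm
    (torusRotation α (skewHomeomorph 0 (-Φ) p))
  simp only [skewHomeomorph_apply, skewHomeomorph_symm_apply, torusRotation, h]
  ext
  · simp
  · simp; abel

/-- The displacement of a skew product over a strip. -/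
lemma exists_skew_displacement {r : ℝ} (hr : 0 < r) (α : ℝ) {ψ : C(UnitAddCircle, ℝ)}
    (hψ : AnalyticOnNhd ℝ (fun x : ℝ => ψ (x : UnitAddCircle)) univ) {Ψ : ℂ → ℂ}
    (hd : DifferentiableOn ℂ Ψ {z | |z.im| < r}) {M : ℝ} (hM : ∀ z : ℂ, |z.im| < r → ‖Ψ z‖ ≤ M)
    (hΨ : ∀ x : ℝ, Ψ x = (ψ (x : UnitAddCircle) : ℝ)) :
    ∃ φ : DispSpace hr, (∀ z ∈ strip r, dispExt φ z = ((α : ℂ), Ψ z.1)) ∧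
      IsDisplacement hr φ (skewDiff α ψ hψ) := by
  obtain ⟨φ, h1, h2⟩ := exists_dispExt_eq hr (Ψ := fun z => ((α : ℂ), Ψ z.1)) (M := max |α| M)
    (f := fun p => (α, ψ (p.1 : UnitAddCircle)))
    ((differentiableOn_const _).prodMk (hd.comp differentiableOn_fst fun z hz => hz.1))
    (fun z hz => by
      rw [Prod.norm_def]
      refine max_le_max (by simp) (hM _ hz.1))
    (fun p => by simp [toComplex, hΨ])
    (fun p m n => by simp)
  refine ⟨φ, h1, isDisplacement_iff.2 fun p => ?_⟩
  rw [h2]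
  simp [skewDiff, skewHomeomorph_apply, proj]


/-! ### Fourier analysis on the circle and approximate cohomological equations -/

instance : IsProbabilityMeasure (volume : Measure UnitAddCircle) :=
  ⟨by simp [AddCircle.measure_univ]⟩

lemma integrable_of_continuous {X E : Type*} [TopologicalSpace X] [CompactSpace X]
    [MeasurableSpace X] [OpensMeasurableSpace X] [NormedAddCommGroup E]
    [SecondCountableTopologyEither X E]
    {μ : Measure X} [IsFiniteMeasure μ] {f : X → E} (hf : Continuous f) : Integrable f μ :=
  hf.integrable_of_hasCompactSupport (HasCompactSupport.of_compactSpace f)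

lemma fourier_apply_add (n : ℤ) (x y : UnitAddCircle) :
    fourier n (x + y) = fourier n x * fourier n y := by
  simp [fourier_apply, smul_add, AddCircle.toCircle_add]

lemma norm_fourier_apply (n : ℤ) (x : UnitAddCircle) : ‖fourier n x‖ = 1 := by
  rw [fourier_apply]; exact Circle.norm_coe _

lemma fourier_coe_eq_exp (k : ℤ) (s : ℝ) :
    fourier k (s : UnitAddCircle) = Complex.exp (Complex.I * ((2 * Real.pi * k * s : ℝ) : ℂ)) := by
  rw [fourier_coe_apply]
  congr 1
  push_cast
  ring

lemma norm_fourier_sub_one_le (k : ℤ) (s : ℝ) :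
    ‖fourier k (s : UnitAddCircle) - 1‖ ≤ 2 * Real.pi * |(k : ℝ)| * |s| := by
  rw [fourier_coe_eq_exp]
  refine Real.norm_exp_I_mul_ofReal_sub_one_le.trans_eq ?_
  rw [Real.norm_eq_abs, abs_mul, abs_mul, abs_of_pos (by positivity)]

lemma fourier_coe_eq_one_iff (k : ℤ) (s : ℝ) :
    fourier k (s : UnitAddCircle) = 1 ↔ ∃ n : ℤ, k * s = n := by
  rw [fourier_coe_eq_exp, Complex.exp_eq_one_iff]
  have h2 : (2 * Real.pi * Complex.I : ℂ) ≠ 0 := Complex.two_pi_I_ne_zero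
  refine exists_congr fun n => ⟨fun h => ?_, fun h => ?_⟩
  · have : ((k * s : ℝ) : ℂ) * (2 * Real.pi * Complex.I) = ((n : ℝ) : ℂ) * (2 * Real.pi * Complex.I) := by
      rw [Complex.ofReal_intCast, ← h]; push_cast; ring
    exact Complex.ofReal_injective (mul_right_cancel₀ h2 this)
  · rw [mul_assoc, h]; push_cast; ring

lemma fourier_irrational_ne_one {α : ℝ} (hα : Irrational α) {m : ℤ} (hm : m ≠ 0) :
    fourier m (α : UnitAddCircle) ≠ 1 := by
  rw [Ne, fourier_coe_eq_one_iff]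
  rintro ⟨n, hn⟩
  exact (hα.intCast_mul hm).ne_int n hn

/-- The common mechanism for the vanishing of Fourier integrals: a measure-preserving change of
variable multiplies the integral by some `c ≠ 1`. -/
lemma eq_zero_of_eq_mul {a c : ℂ} (hc : c ≠ 1) (h : a = c * a) : a = 0 := by
  have : (c - 1) * a = 0 := by rw [sub_mul, one_mul, ← h, sub_self]
  exact (mul_eq_zero.1 this).resolve_left (sub_ne_zero.2 hc)

lemma integral_fourier_eq_zero {m : ℤ} (hm : m ≠ 0) : ∫ x : UnitAddCircle, fourier m x = 0 := by
  have hα := fourier_irrational_ne_one irrational_sqrt_two hm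
  refine eq_zero_of_eq_mul hα ?_
  rw [← integral_const_mul]
  nth_rewrite 1 [← integral_add_right_eq_self _ ((√2 : ℝ) : UnitAddCircle)]
  simp only [fourier_apply_add, mul_comm]

lemma exists_span_fourier_close (g : C(UnitAddCircle, ℂ)) {δ : ℝ} (hδ : 0 < δ) :
    ∃ P ∈ Submodule.span ℂ (range (fourier (T := 1))), ∀ x, ‖g x - P x‖ ≤ δ := by
  have h : g ∈ (Submodule.span ℂ (range (fourier (T := 1)))).topologicalClosure := by
    rw [span_fourier_closure_eq_top]; trivial
  obtain ⟨P, hP, hd⟩ := Metric.mem_closure_iff.1 h δ hδ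
  refine ⟨P, hP, fun x => ?_⟩
  rw [← dist_eq_norm]
  exact (ContinuousMap.dist_apply_le_dist x).trans hd.le

lemma integral_continuousMap_add (P Q : C(UnitAddCircle, ℂ)) :
    ∫ y, (P + Q) y = (∫ y, P y) + ∫ y, Q y := by
  simp only [ContinuousMap.add_apply]
  exact integral_add (integrable_of_continuous P.continuous)
    (integrable_of_continuous Q.continuous)

/-- Trigonometric polynomials of mean zero are coboundaries over irrational rotations. -/
lemma exists_coboundary_of_mem_span {α : ℝ} (hα : Irrational α) {P : C(UnitAddCircle, ℂ)}
    (hP : P ∈ Submodule.span ℂ (range (fourier (T := 1)))) :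
    ∃ h : C(UnitAddCircle, ℂ), ∀ x, P x - ∫ y, P y = h (x + (α : UnitAddCircle)) - h x := by
  induction hP using Submodule.span_induction with
  | mem P hP =>
    obtain ⟨m, rfl⟩ := hP
    by_cases hm : m = 0
    · exact ⟨0, fun x => by simp [hm]⟩
    · have h1 := sub_ne_zero.2 (fourier_irrational_ne_one hα hm)
      -- The divisor may be tiny; no lower bound is needed, since only trigonometric polynomials are
      -- solved for.
      refine ⟨(fourier m (α : UnitAddCircle) - 1)⁻¹ • fourier m, fun x => ?_⟩
      rw [integral_fourier_eq_zero hm]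
      simp only [ContinuousMap.smul_apply, smul_eq_mul, fourier_apply_add]
      field_simp
      ring
  | zero => exact ⟨0, fun x => by simp⟩
  | add P Q _ _ hP hQ =>
    obtain ⟨h, hh⟩ := hP
    obtain ⟨k, hk⟩ := hQ
    refine ⟨h + k, fun x => ?_⟩
    have : ∫ y, (P + Q) y = (∫ y, P y) + ∫ y, Q y :=
      integral_continuousMap_add P Q
    rw [this]
    simp only [ContinuousMap.add_apply]
    linear_combination hh x + hk x
  | smul c P _ hP =>
    obtain ⟨h, hh⟩ := hP
    refine ⟨c • h, fun x => ?_⟩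
    have : ∫ y, (c • P) y = c * ∫ y, P y := integral_const_mul _ _
    rw [this]
    simp only [ContinuousMap.smul_apply, smul_eq_mul]
    linear_combination c * hh x

lemma norm_integral_sub_le {g P : C(UnitAddCircle, ℂ)} {δ : ℝ} (h : ∀ x, ‖g x - P x‖ ≤ δ) :
    ‖(∫ x, g x) - ∫ x, P x‖ ≤ δ := by
  rw [← integral_sub (integrable_of_continuous g.continuous)
    (integrable_of_continuous P.continuous)]
  simpa using norm_integral_le_of_norm_le_const (μ := volume) (Eventually.of_forall h)

/-- Continuous functions of mean zero are uniformly close to coboundaries over irrational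
rotations. -/
lemma exists_approx_coboundary {α : ℝ} (hα : Irrational α) (g : C(UnitAddCircle, ℂ)) {δ : ℝ}
    (hδ : 0 < δ) : ∃ h : C(UnitAddCircle, ℂ),
      ∀ x, ‖(g x - ∫ y, g y) - (h (x + (α : UnitAddCircle)) - h x)‖ ≤ δ := by
  obtain ⟨P, hP, hgP⟩ := exists_span_fourier_close g (half_pos hδ)
  obtain ⟨h, hh⟩ := exists_coboundary_of_mem_span hα hP
  refine ⟨h, fun x => ?_⟩
  rw [← hh x, sub_sub_sub_comm]
  refine (norm_sub_le _ _).trans ?_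
  linarith [hgP x, norm_integral_sub_le hgP]

/-- Translation by `1 / q` fixes `v (q • x)` and multiplies `fourier m` by `e(m / q)`, which is not
`1` once `q > |m| > 0`. For `m = 0` it is the invariance of Haar measure under multiplication by
`q`. -/
lemma integral_span_mul_comp_nsmul (v : C(UnitAddCircle, ℂ)) {P : C(UnitAddCircle, ℂ)}
    (hP : P ∈ Submodule.span ℂ (range (fourier (T := 1)))) :
    ∀ᶠ q : ℕ in atTop, ∫ x, P x * v (q • x) = (∫ x, P x) * ∫ x, v x := by
  have hi : ∀ (P : C(UnitAddCircle, ℂ)) (q : ℕ),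
      Integrable (fun x => P x * v (q • x)) (volume : Measure UnitAddCircle) := fun P q =>
    integrable_of_continuous (by fun_prop)
  induction hP using Submodule.span_induction with
  | mem P hP =>
    obtain ⟨m, rfl⟩ := hP
    by_cases hm : m = 0
    · filter_upwards [eventually_gt_atTop 0] with q hq
      have hmp : MeasurePreserving (fun x : UnitAddCircle => (q : ℤ) • x) volume volume :=
        MeasureTheory.Measure.measurePreserving_zsmul volume (by exact_mod_cast hq.ne')
      have := integral_map (μ := volume) hmp.measurable.aemeasurable
        (f := v) v.continuous.aestronglyMeasurable
      rw [hmp.map_eq] at this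
      simp [hm, this]
    · filter_upwards [eventually_gt_atTop m.natAbs] with q hq
      have hq0 : (q : ℝ) ≠ 0 := by
        have : 0 < q := by omega
        positivity
      rw [integral_fourier_eq_zero hm, zero_mul]
      refine eq_zero_of_eq_mul (c := fourier m (((q : ℝ)⁻¹ : ℝ) : UnitAddCircle)) ?_ ?_
      · rw [Ne, fourier_coe_eq_one_iff]
        rintro ⟨n, hn⟩
        have h1 : (m : ℝ) = n * q := by field_simp at hn; linarith
        have h2 : m = n * q := by exact_mod_cast h1
        have h3 : m.natAbs = n.natAbs * q := by rw [h2, Int.natAbs_mul]; simp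
        have h4 : n.natAbs ≠ 0 := by
          rintro h; rw [h, zero_mul] at h3; omega
        have : q ≤ n.natAbs * q := Nat.le_mul_of_pos_left _ (Nat.pos_of_ne_zero h4)
        omega
      · rw [← integral_const_mul]
        nth_rewrite 1 [← integral_add_right_eq_self _ (((q : ℝ)⁻¹ : ℝ) : UnitAddCircle)]
        have hz : q • (((q : ℝ)⁻¹ : ℝ) : UnitAddCircle) = 0 := by
          rw [← AddCircle.coe_nsmul, nsmul_eq_mul, mul_inv_cancel₀ hq0]
          exact AddCircle.coe_period 1
        refine integral_congr_ae (Eventually.of_forall fun x => ?_)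
        simp only [fourier_apply_add, smul_add, hz, add_zero]
        ring
  | zero => exact Eventually.of_forall fun q => by simp
  | add P Q _ _ hP hQ =>
    filter_upwards [hP, hQ] with q h1 h2
    have e1 : ∫ y, (P + Q) y = (∫ y, P y) + ∫ y, Q y :=
      integral_continuousMap_add P Q
    rw [e1, add_mul, ← h1, ← h2, ← integral_add (hi P q) (hi Q q)]
    simp only [ContinuousMap.add_apply, add_mul]
  | smul c P _ hP =>
    filter_upwards [hP] with q h1
    have e1 : ∫ y, (c • P) y = c * ∫ y, P y := integral_const_mul _ _
    rw [e1, mul_assoc, ← h1, ← integral_const_mul]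
    simp only [ContinuousMap.smul_apply, smul_eq_mul, mul_assoc]

/-- Fejér's lemma. -/
lemma tendsto_integral_mul_comp_nsmul (g v : C(UnitAddCircle, ℂ)) :
    Tendsto (fun q : ℕ => ∫ x, g x * v (q • x)) atTop (𝓝 ((∫ x, g x) * ∫ x, v x)) := by
  rw [Metric.tendsto_atTop']
  intro ε hε
  have hv : ∀ x, ‖v x‖ ≤ ‖v‖ := v.norm_coe_le_norm
  set δ := ε / (2 * ‖v‖ + 1) with hδ
  have hδ0 : 0 < δ := by positivity
  obtain ⟨P, hP, hgP⟩ := exists_span_fourier_close g hδ0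
  obtain ⟨N, hN⟩ := eventually_atTop.1 (integral_span_mul_comp_nsmul v hP)
  refine ⟨N, fun q hq => ?_⟩
  have h1 : ‖(∫ x, g x * v (q • x)) - ∫ x, P x * v (q • x)‖ ≤ δ * ‖v‖ := by
    rw [← integral_sub (integrable_of_continuous (by fun_prop))
      (integrable_of_continuous (by fun_prop))]
    have : ∀ x : UnitAddCircle, ‖g x * v (q • x) - P x * v (q • x)‖ ≤ δ * ‖v‖ := fun x => by
      rw [← sub_mul, norm_mul]
      exact mul_le_mul (hgP x) (hv _) (norm_nonneg _) hδ0.le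
    simpa using norm_integral_le_of_norm_le_const (μ := volume) (Eventually.of_forall this)
  have h2 : ‖∫ x, v x‖ ≤ ‖v‖ := by
    simpa using norm_integral_le_of_norm_le_const (μ := volume) (Eventually.of_forall hv)
  have h3 : ‖(∫ x, P x) * (∫ x, v x) - (∫ x, g x) * ∫ x, v x‖ ≤ δ * ‖v‖ := by
    rw [← sub_mul, norm_mul, norm_sub_rev]
    exact mul_le_mul (norm_integral_sub_le hgP) h2 (norm_nonneg _) hδ0.le
  rw [dist_eq_norm]
  calc _ ≤ ‖(∫ x, g x * v (q • x)) - ∫ x, P x * v (q • x)‖ +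
        ‖(∫ x, P x * v (q • x)) - (∫ x, g x) * ∫ x, v x‖ := norm_sub_le_norm_sub_add_norm_sub _ _ _
    _ ≤ δ * ‖v‖ + δ * ‖v‖ := by
        refine add_le_add h1 ?_
        rw [hN q hq.le]; exact h3
    _ < δ * (2 * ‖v‖ + 1) := by linarith
    _ = ε := by rw [hδ]; field_simp

/-- The function `sin (2 π q x)` on the circle. -/
def wave (q : ℕ) : C(UnitAddCircle, ℝ) := ⟨fun x => (fourier (q : ℤ) x).im, by fun_prop⟩

lemma wave_coe (q : ℕ) (x : ℝ) : wave q (x : UnitAddCircle) = Real.sin (2 * Real.pi * q * x) := by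
  change (fourier (q : ℤ) (x : UnitAddCircle)).im = _
  rw [fourier_coe_eq_exp, mul_comm, Complex.exp_ofReal_mul_I_im]
  simp

lemma wave_eq_nsmul (q : ℕ) (x : UnitAddCircle) : wave q x = wave 1 (q • x) := by
  simp [wave, fourier_apply]

/-- The function `e(m x + k Φ(x))` on the circle. -/
def twist (m k : ℤ) (Φ : C(UnitAddCircle, ℝ)) : C(UnitAddCircle, ℂ) :=
  ⟨fun x => fourier m x * fourier k ((Φ x : ℝ) : UnitAddCircle), by
    have : Continuous fun x => ((Φ x : ℝ) : UnitAddCircle) :=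
      (AddCircle.continuous_mk' 1).comp Φ.continuous
    fun_prop⟩

lemma twist_apply (m k : ℤ) (Φ : C(UnitAddCircle, ℝ)) (x : UnitAddCircle) :
    twist m k Φ x = fourier m x * fourier k ((Φ x : ℝ) : UnitAddCircle) := rfl

lemma norm_twist_apply (m k : ℤ) (Φ : C(UnitAddCircle, ℝ)) (x : UnitAddCircle) :
    ‖twist m k Φ x‖ = 1 := by
  rw [twist_apply, norm_mul, norm_fourier_apply, norm_fourier_apply, one_mul]

/-- The added factor is a fixed function evaluated at `q • x`, so this is Fejér's lemma. -/
lemma tendsto_integral_twist_add_wave (m k : ℤ) (Φ : C(UnitAddCircle, ℝ)) :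
    Tendsto (fun q : ℕ => ∫ x, twist m k (Φ + wave q) x) atTop
      (𝓝 ((∫ x, twist m k Φ x) * ∫ x, twist 0 k (wave 1) x)) := by
  refine (tendsto_integral_mul_comp_nsmul (twist m k Φ) (twist 0 k (wave 1))).congr fun q => ?_
  refine integral_congr_ae (Eventually.of_forall fun x => ?_)
  simp only [twist_apply, ContinuousMap.add_apply, AddCircle.coe_add, fourier_apply_add,
    ← wave_eq_nsmul, fourier_zero, one_mul, mul_assoc]

/-- Equality in the triangle inequality would force `e(k sin 2πx)` to be constant, but it equals `1`
at `0` and `e(1/2) = -1` where the sine is `1 / (2k)`. -/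
lemma norm_integral_twist_wave_lt_one {k : ℤ} (hk : k ≠ 0) :
    ‖∫ x, twist 0 k (wave 1) x‖ < 1 := by
  set v := twist 0 k (wave 1) with hv
  have hv1 : ∀ x, ‖v x‖ = 1 := norm_twist_apply _ _ _
  have hle : ‖∫ x, v x‖ ≤ 1 := by
    simpa using norm_integral_le_of_norm_le_const (μ := volume)
      (Eventually.of_forall fun x => (hv1 x).le)
  refine hle.lt_of_ne fun heq => ?_
  set J := ∫ x, v x with hJ
  have hJJ : (starRingEnd ℂ) J * J = 1 := by
    rw [← Complex.normSq_eq_conj_mul_self, Complex.normSq_eq_norm_sq, heq]; simp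
  -- If `‖J‖ = 1`, this is a nonnegative continuous function with integral zero, hence zero.
  set f : UnitAddCircle → ℝ := fun x => 1 - ((starRingEnd ℂ) J * v x).re with hf
  have hfc : Continuous f := by fun_prop
  have hf0 : ∀ x, 0 ≤ f x := fun x => by
    have := (Complex.re_le_norm ((starRingEnd ℂ) J * v x))
    rw [norm_mul, RCLike.norm_conj, heq, hv1, one_mul] at this
    simp only [hf]; linarith
  have hfi : ∫ x, f x = 0 := by
    have hi : Integrable (fun x => (starRingEnd ℂ) J * v x) (volume : Measure UnitAddCircle) :=
      integrable_of_continuous (by fun_prop)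
    simp only [hf]
    have h1 : Integrable (fun x => ((starRingEnd ℂ) J * v x).re) volume := hi.re
    have h2 : ∫ x, ((starRingEnd ℂ) J * v x).re = (∫ x, (starRingEnd ℂ) J * v x).re :=
      integral_re hi
    rw [integral_sub (integrable_const _) h1, h2, integral_const_mul, ← hJ, hJJ]
    simp
  have hfz : f = 0 :=
    (hfc.ae_eq_iff_eq volume continuous_zero).1
      ((integral_eq_zero_iff_of_nonneg hf0 (integrable_of_continuous hfc)).1 hfi)
  have hvx : ∀ x, (starRingEnd ℂ) J * v x = 1 := fun x => by
    have h1 : ((starRingEnd ℂ) J * v x).re = 1 := by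
      have := congrFun hfz x
      simp only [hf, Pi.zero_apply] at this
      linarith
    have h2 : ‖(starRingEnd ℂ) J * v x‖ = 1 := by
      rw [norm_mul, RCLike.norm_conj, heq, hv1, one_mul]
    have h3 : ((starRingEnd ℂ) J * v x).im = 0 := by
      have := Complex.sq_norm ((starRingEnd ℂ) J * v x)
      rw [h2, Complex.normSq_apply, h1] at this
      nlinarith
    exact Complex.ext h1 h3
  have hconst : ∀ x, v x = v 0 := fun x => by
    have hne : (starRingEnd ℂ) J ≠ 0 := left_ne_zero_of_mul_eq_one hJJ
    exact mul_left_cancel₀ hne ((hvx x).trans (hvx 0).symm)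
  have hk1 : (1 : ℝ) ≤ |(k : ℝ)| := by exact_mod_cast Int.one_le_abs hk
  have hk0 : (k : ℝ) ≠ 0 := by exact_mod_cast hk
  set a : ℝ := 1 / (2 * k) with ha
  have haa : |a| ≤ 1 := by
    rw [ha, abs_div, abs_mul, abs_one, abs_two, div_le_one (by positivity)]
    linarith
  have hx := hconst ((Real.arcsin a / (2 * Real.pi) : ℝ) : UnitAddCircle)
  have h0 : v 0 = 1 := by simp [hv, twist_apply, wave]
  rw [h0, hv, twist_apply, wave_coe, fourier_zero, one_mul] at hx
  have hs : 2 * Real.pi * ((1 : ℕ) : ℝ) * (Real.arcsin a / (2 * Real.pi)) = Real.arcsin a := by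
    have := Real.pi_pos
    push_cast
    field_simp
  rw [hs, Real.sin_arcsin (abs_le.1 haa).1 (abs_le.1 haa).2, fourier_coe_eq_one_iff] at hx
  obtain ⟨n, hn⟩ := hx
  have : (1 : ℝ) = 2 * n := by rw [← hn, ha]; field_simp
  have h' : (1 : ℤ) = 2 * n := by exact_mod_cast this
  omega


/-! ### Invariant measures of skew products -/

/-- The functions `f` with equal integrals form a closed subspace containing the characters, whose
span is dense. With the weight `w` this can be applied to one coordinate at a time. -/
lemma integral_comp_mul_eq_of_fourier {μ ν : Measure Torus} [IsProbabilityMeasure μ]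
    [IsProbabilityMeasure ν] {π : Torus → UnitAddCircle} (hπ : Continuous π) {w : Torus → ℂ}
    (hw : Continuous w)
    (h : ∀ m : ℤ, ∫ p, fourier m (π p) * w p ∂μ = ∫ p, fourier m (π p) * w p ∂ν)
    (f : C(UnitAddCircle, ℂ)) : ∫ p, f (π p) * w p ∂μ = ∫ p, f (π p) * w p ∂ν := by
  obtain ⟨W, hW⟩ : ∃ W, ∀ p, ‖w p‖ ≤ W := ⟨_, (ContinuousMap.mk w hw).norm_coe_le_norm⟩
  have hi : ∀ (κ : Measure Torus) [IsProbabilityMeasure κ] (f : C(UnitAddCircle, ℂ)),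
      Integrable (fun p => f (π p) * w p) κ := fun κ _ f => integrable_of_continuous (by fun_prop)
  have hcont : ∀ (κ : Measure Torus) [IsProbabilityMeasure κ],
      Continuous fun f : C(UnitAddCircle, ℂ) => ∫ p, f (π p) * w p ∂κ := by
    intro κ _
    refine (LipschitzWith.of_dist_le_mul (K := W.toNNReal) fun f g => ?_).continuous
    have hW0 : 0 ≤ W := (norm_nonneg _).trans (hW 0)
    rw [dist_eq_norm, ← integral_sub (hi κ f) (hi κ g), Real.coe_toNNReal _ hW0]
    have : ∀ p, ‖f (π p) * w p - g (π p) * w p‖ ≤ W * dist f g := fun p => by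
      rw [← sub_mul, norm_mul, mul_comm, ← dist_eq_norm]
      exact mul_le_mul (hW p) (ContinuousMap.dist_apply_le_dist _) dist_nonneg hW0
    simpa using norm_integral_le_of_norm_le_const (μ := κ) (Eventually.of_forall this)
  have hcl : IsClosed {f : C(UnitAddCircle, ℂ) |
      ∫ p, f (π p) * w p ∂μ = ∫ p, f (π p) * w p ∂ν} := isClosed_eq (hcont μ) (hcont ν)
  have hspan : ((Submodule.span ℂ (range (fourier (T := 1))) : Submodule ℂ C(UnitAddCircle, ℂ)) :
      Set C(UnitAddCircle, ℂ)) ⊆ {f | ∫ p, f (π p) * w p ∂μ = ∫ p, f (π p) * w p ∂ν} := by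
    intro P hP
    induction hP using Submodule.span_induction with
    | mem P hP => obtain ⟨m, rfl⟩ := hP; exact h m
    | zero => simp
    | add P Q _ _ hP hQ =>
      have : ∀ (κ : Measure Torus) [IsProbabilityMeasure κ], ∫ p, (P + Q) (π p) * w p ∂κ =
          (∫ p, P (π p) * w p ∂κ) + ∫ p, Q (π p) * w p ∂κ := fun κ _ => by
        rw [← integral_add (hi κ P) (hi κ Q)]
        simp only [ContinuousMap.add_apply, add_mul]
      rw [mem_ofPred_eq] at hP hQ ⊢
      rw [this μ, this ν, hP, hQ]
    | smul c P _ hP =>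
      have : ∀ (κ : Measure Torus), ∫ p, (c • P) (π p) * w p ∂κ =
          c * ∫ p, P (π p) * w p ∂κ := fun κ => by
        rw [← integral_const_mul]
        simp only [ContinuousMap.smul_apply, smul_eq_mul, mul_assoc]
      rw [mem_ofPred_eq] at hP ⊢
      rw [this μ, this ν, hP]
  have hf : f ∈ (Submodule.span ℂ (range (fourier (T := 1)))).topologicalClosure := by
    rw [span_fourier_closure_eq_top]; trivial
  exact closure_minimal hspan hcl hf

/-- Probability measures on the torus are determined by their Fourier coefficients. -/
lemma measure_ext_of_fourier {μ ν : Measure Torus} [IsProbabilityMeasure μ]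
    [IsProbabilityMeasure ν]
    (h : ∀ m k : ℤ, ∫ p, fourier m p.1 * fourier k p.2 ∂μ = ∫ p, fourier m p.1 * fourier k p.2 ∂ν) :
    μ = ν := by
  have h1 : ∀ (f : C(UnitAddCircle, ℂ)) (k : ℤ),
      ∫ p, f p.1 * fourier k p.2 ∂μ = ∫ p, f p.1 * fourier k p.2 ∂ν := fun f k =>
    integral_comp_mul_eq_of_fourier continuous_fst (w := fun p => fourier k p.2) (by fun_prop)
      (fun m => h m k) f
  have h2 : ∀ f g : C(UnitAddCircle, ℂ), ∫ p, g p.2 * f p.1 ∂μ = ∫ p, g p.2 * f p.1 ∂ν :=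
    fun f g => integral_comp_mul_eq_of_fourier continuous_snd (w := fun p => f p.1) (by fun_prop)
      (fun k => by simpa only [mul_comm] using h1 f k) g
  refine Measure.ext_of_integral_mul_boundedContinuousFunction fun f g => ?_
  have := h2 ⟨fun x => (f x : ℂ), by fun_prop⟩ ⟨fun x => (g x : ℂ), by fun_prop⟩
  simp only [ContinuousMap.coe_mk, ← Complex.ofReal_mul, integral_complex_ofReal] at this
  simpa only [mul_comm] using Complex.ofReal_injective this

section Invariant

variable {α : ℝ} {ψ : C(UnitAddCircle, ℝ)} {μ : Measure Torus}

lemma integral_comp_skew (hμ : MeasurePreserving (skewHomeomorph α ψ) μ μ) (F : Torus → ℂ) :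
    ∫ p, F (skewHomeomorph α ψ p) ∂μ = ∫ p, F p ∂μ :=
  hμ.integral_comp (skewHomeomorph α ψ).measurableEmbedding F

lemma integral_fourier_fst_eq_zero (hα : Irrational α)
    (hμ : MeasurePreserving (skewHomeomorph α ψ) μ μ) {m : ℤ} (hm : m ≠ 0) :
    ∫ p : Torus, fourier m p.1 * fourier 0 p.2 ∂μ = 0 := by
  simp only [fourier_zero, mul_one]
  refine eq_zero_of_eq_mul (fourier_irrational_ne_one hα hm) ?_
  rw [← integral_const_mul]
  nth_rewrite 1 [← integral_comp_skew hμ]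
  simp only [skewHomeomorph_apply, fourier_apply_add, mul_comm]

/-- The character factors as the twist times `u = e(k(y - Φ(x)))`. The mean of the twist gives the
first term and the error in the cohomological equation the second; the third pairs `h` with the
change of `u` under the skew product, which is at most `2π|k|b`. -/
lemma norm_integral_fourier_le [IsProbabilityMeasure μ]
    (hμ : MeasurePreserving (skewHomeomorph α ψ) μ μ) (m k : ℤ) (Φ : C(UnitAddCircle, ℝ))
    (h : C(UnitAddCircle, ℂ)) {b δ : ℝ}
    (hb : ∀ x, |ψ x - (Φ (x + (α : UnitAddCircle)) - Φ x)| ≤ b)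
    (hδ : ∀ x, ‖(twist m k Φ x - ∫ y, twist m k Φ y) - (h (x + (α : UnitAddCircle)) - h x)‖ ≤ δ) :
    ‖∫ p : Torus, fourier m p.1 * fourier k p.2 ∂μ‖ ≤
      ‖∫ y, twist m k Φ y‖ + δ + 2 * Real.pi * |(k : ℝ)| * (b * ‖h‖) := by
  set c := ∫ y, twist m k Φ y with hc
  set u : Torus → ℂ := fun p => fourier k (p.2 - ((Φ p.1 : ℝ) : UnitAddCircle)) with hu
  have hΦc : Continuous fun p : Torus => ((Φ p.1 : ℝ) : UnitAddCircle) :=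
    (AddCircle.continuous_mk' 1).comp (Φ.continuous.comp continuous_fst)
  have huc : Continuous u := by fun_prop
  have hu1 : ∀ p, ‖u p‖ = 1 := fun p => norm_fourier_apply _ _
  have hfac : ∀ p : Torus, fourier m p.1 * fourier k p.2 = twist m k Φ p.1 * u p := fun p => by
    rw [twist_apply, mul_assoc, hu, ← fourier_apply_add, add_sub_cancel]
  have huG : ∀ p, ‖u p - u (skewHomeomorph α ψ p)‖ ≤ 2 * Real.pi * |(k : ℝ)| * b := fun p => by
    have : u (skewHomeomorph α ψ p) = u p * fourier k
        ((ψ p.1 - (Φ (p.1 + (α : UnitAddCircle)) - Φ p.1) : ℝ) : UnitAddCircle) := by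
      simp only [hu, ← fourier_apply_add, skewHomeomorph_apply]
      congr 1
      rw [AddCircle.coe_sub, AddCircle.coe_sub]
      abel
    rw [this, ← mul_one_sub, norm_mul, hu1, one_mul, norm_sub_rev]
    refine (norm_fourier_sub_one_le _ _).trans ?_
    gcongr
    exact hb _
  set A := ∫ p, ((twist m k Φ p.1 - c) - (h (p.1 + (α : UnitAddCircle)) - h p.1)) * u p ∂μ with hA
  set B := ∫ p, h (p.1 + (α : UnitAddCircle)) * (u p - u (skewHomeomorph α ψ p)) ∂μ with hB
  -- Summation by parts: invariance of `μ` moves the difference from `h` to `u`.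
  have hBeq : B = ∫ p, (h (p.1 + (α : UnitAddCircle)) - h p.1) * u p ∂μ := by
    have e := integral_comp_skew hμ fun p => h p.1 * u p
    simp only [skewHomeomorph_apply] at e
    simp only [hB, mul_sub, sub_mul]
    rw [integral_sub (integrable_of_continuous (by fun_prop))
      (integrable_of_continuous (by
        have := (skewHomeomorph α ψ).continuous; fun_prop)),
      integral_sub (integrable_of_continuous (by fun_prop))
      (integrable_of_continuous (by fun_prop)), ← e]
    rfl
  have hI : ∫ p : Torus, fourier m p.1 * fourier k p.2 ∂μ = c * (∫ p, u p ∂μ) + A + B := by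
    rw [hBeq, hA, ← integral_const_mul, ← integral_add, ← integral_add]
    · refine integral_congr_ae (Eventually.of_forall fun p => ?_)
      simp only [hfac]
      ring
    all_goals exact integrable_of_continuous (by fun_prop)
  have hbound : ∀ (f : Torus → ℂ) (M : ℝ), (∀ p, ‖f p‖ ≤ M) → ‖∫ p, f p ∂μ‖ ≤ M := by
    intro f M hf
    simpa using norm_integral_le_of_norm_le_const (μ := μ) (Eventually.of_forall hf)
  have h1 : ‖c * ∫ p, u p ∂μ‖ ≤ ‖c‖ := by
    rw [norm_mul]
    exact mul_le_of_le_one_right (norm_nonneg _) (hbound u 1 fun p => (hu1 p).le)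
  have h2 : ‖A‖ ≤ δ := hbound _ _ fun p => by
    rw [norm_mul, hu1, mul_one]; exact hδ _
  have h3 : ‖B‖ ≤ 2 * Real.pi * |(k : ℝ)| * (b * ‖h‖) := hbound _ _ fun p => by
    rw [norm_mul, ← mul_assoc, mul_comm _ ‖h‖]
    exact mul_le_mul (h.norm_coe_le_norm _) (huG p) (norm_nonneg _) (norm_nonneg _)
  rw [hI]
  refine (norm_add_le _ _).trans (add_le_add ((norm_add_le _ _).trans (add_le_add h1 h2)) h3)

end Invariant

/-- A criterion for unique ergodicity of skew products that are well approximated by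
coboundaries. -/
lemma uniquelyErgodic_skew {α : ℝ} (hα : Irrational α) {ψ : C(UnitAddCircle, ℝ)}
    {Φ : ℕ → C(UnitAddCircle, ℝ)} {b : ℕ → ℝ}
    (hb : ∀ n x, |ψ x - (Φ n (x + (α : UnitAddCircle)) - Φ n x)| ≤ b n)
    (hc : ∀ m k : ℤ, k ≠ 0 → Tendsto (fun n => ∫ x, twist m k (Φ n) x) atTop (𝓝 0))
    (hh : ∀ m k : ℤ, ∀ᶠ n : ℕ in atTop, ∃ h : C(UnitAddCircle, ℂ),
      (∀ x, ‖(twist m k (Φ n) x - ∫ y, twist m k (Φ n) y) -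
        (h (x + (α : UnitAddCircle)) - h x)‖ ≤ 1 / (n + 1)) ∧ b n * ‖h‖ ≤ 1 / (n + 1)) :
    UniquelyErgodic (skewHomeomorph α ψ) := by
  have hzero : ∀ (μ : Measure Torus), IsProbabilityMeasure μ →
      MeasurePreserving (skewHomeomorph α ψ) μ μ → ∀ m k : ℤ, ¬(m = 0 ∧ k = 0) →
      ∫ p : Torus, fourier m p.1 * fourier k p.2 ∂μ = 0 := by
    intro μ _ hμ m k hmk
    by_cases hk : k = 0
    · subst hk
      exact integral_fourier_fst_eq_zero hα hμ fun hm => hmk ⟨hm, rfl⟩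
    · have ht : Tendsto (fun n : ℕ => ‖∫ x, twist m k (Φ n) x‖ + 1 / ((n : ℝ) + 1) +
          2 * Real.pi * |(k : ℝ)| * (1 / ((n : ℝ) + 1))) atTop (𝓝 0) := by
        have h1 := (hc m k hk).norm
        have h2 := tendsto_one_div_add_atTop_nhds_zero_nat (𝕜 := ℝ)
        simpa using (h1.add h2).add (h2.const_mul (2 * Real.pi * |(k : ℝ)|))
      rw [← norm_le_zero_iff]
      refine ge_of_tendsto ht ?_
      filter_upwards [hh m k] with n hn
      obtain ⟨h, hδ, hbh⟩ := hn
      refine (norm_integral_fourier_le hμ m k (Φ n) h (hb n) hδ).trans ?_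
      gcongr
  refine ⟨volume, ⟨inferInstance, skewHomeomorph_measurePreserving α ψ⟩, ?_⟩
  rintro μ ⟨hμ, hμ'⟩
  refine measure_ext_of_fourier fun m k => ?_
  by_cases hmk : m = 0 ∧ k = 0
  · simp [hmk.1, hmk.2]
  · rw [hzero μ hμ hμ' m k hmk,
      hzero volume inferInstance (skewHomeomorph_measurePreserving α ψ) m k hmk]


/-! ### Super-Liouville numbers -/

/-- Irrational numbers with super-exponentially good rational approximations. -/
def SuperLiouville (α : ℝ) : Prop :=
  Irrational α ∧ ∀ n : ℕ, ∃ q ≥ n, ∃ p : ℤ, |(q : ℝ) * α - p| < Real.exp (-(q : ℝ) ^ 2)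

/-- Each approximation condition is open and holds at every rational, with error zero along
multiples of the denominator; Baire's theorem does the rest. -/
lemma isGδ_superLiouville : IsGδ {α | SuperLiouville α} ∧ Dense {α | SuperLiouville α} := by
  have hset : {α | SuperLiouville α} = {α | Irrational α} ∩ ⋂ n : ℕ, ⋃ q ≥ n, ⋃ p : ℤ,
      {α : ℝ | |(q : ℝ) * α - p| < Real.exp (-(q : ℝ) ^ 2)} := by
    ext α; simp [SuperLiouville]
  have hopen : ∀ n : ℕ, IsOpen (⋃ q ≥ n, ⋃ p : ℤ,
      {α : ℝ | |(q : ℝ) * α - p| < Real.exp (-(q : ℝ) ^ 2)}) := fun n =>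
    isOpen_biUnion fun q _ => isOpen_iUnion fun p => isOpen_lt (by fun_prop) continuous_const
  have hdense : ∀ n : ℕ, Dense (⋃ q ≥ n, ⋃ p : ℤ,
      {α : ℝ | |(q : ℝ) * α - p| < Real.exp (-(q : ℝ) ^ 2)}) := fun n => by
    refine Dense.mono ?_ (Rat.denseRange_cast (𝕜 := ℝ))
    rintro _ ⟨x, rfl⟩
    simp only [mem_iUnion]
    refine ⟨x.den * (n + 1), ?_, x.num * (n + 1), ?_⟩
    · have := x.pos
      nlinarith
    · have hx : (x.den : ℝ) * (x : ℝ) = x.num := by exact_mod_cast x.den_mul_eq_num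
      have : ((x.den * (n + 1) : ℕ) : ℝ) * (x : ℝ) - ((x.num * (n + 1) : ℤ) : ℝ) = 0 := by
        push_cast
        linear_combination ((n : ℝ) + 1) * hx
      rw [mem_ofPred_eq, this, abs_zero]
      positivity
  have hG := IsGδ.iInter_of_isOpen hopen
  have hD := dense_iInter_of_isOpen hopen hdense
  rw [hset]
  exact ⟨IsGδ.setOfPred_irrational.inter hG, dense_irrational.inter_of_Gδ IsGδ.setOfPred_irrational hG hD⟩

/-- Density passes to the interval because a nonempty relatively open subset meets `Ioo 0 1`, which
is open in `ℝ`. -/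
lemma dense_preimage_Icc {s : Set ℝ} (hs : Dense s) :
    Dense ((↑) ⁻¹' s : Set (Icc (0 : ℝ) 1)) := by
  rw [dense_iff_inter_open]
  rintro U hU ⟨x, hx⟩
  obtain ⟨V, hV, rfl⟩ := isOpen_induced_iff.1 hU
  have hx' : (x : ℝ) ∈ closure (Ioo (0 : ℝ) 1) := by
    rw [closure_Ioo (zero_ne_one)]; exact x.2
  obtain ⟨y, hyV, hyI⟩ := mem_closure_iff.1 hx' V hV hx
  obtain ⟨z, hz, hzs⟩ := hs.inter_open_nonempty _ (hV.inter isOpen_Ioo) ⟨y, hyV, hyI⟩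
  exact ⟨⟨z, Ioo_subset_Icc_self hz.2⟩, hz.1, hzs⟩

/-! ### Construction of the cocycle -/

/-- The coboundary `x ↦ Φ(x + α) - Φ(x)`. -/
def coboundary (α : ℝ) (Φ : C(UnitAddCircle, ℝ)) : C(UnitAddCircle, ℝ) :=
  ⟨fun x => Φ (x + (α : UnitAddCircle)) - Φ x, by fun_prop⟩

lemma coboundary_apply (α : ℝ) (Φ : C(UnitAddCircle, ℝ)) (x : UnitAddCircle) :
    coboundary α Φ x = Φ (x + (α : UnitAddCircle)) - Φ x := rfl

lemma coboundary_add (α : ℝ) (Φ Φ' : C(UnitAddCircle, ℝ)) :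
    coboundary α (Φ + Φ') = coboundary α Φ + coboundary α Φ' := by
  ext x; simp only [coboundary_apply, ContinuousMap.add_apply]; ring

/-- The entire extension of the coboundary of `sin (2 π q x)`. -/
def coboundaryWave (α : ℝ) (q : ℕ) (z : ℂ) : ℂ :=
  ((2 * Real.sin (Real.pi * q * α) : ℝ) : ℂ) *
    Complex.cos (2 * Real.pi * q * z + Real.pi * q * α)

lemma coboundaryWave_ofReal (α : ℝ) (q : ℕ) (x : ℝ) :
    coboundaryWave α q x = (coboundary α (wave q) (x : UnitAddCircle) : ℝ) := by
  have : coboundary α (wave q) (x : UnitAddCircle) =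
      2 * Real.sin (Real.pi * q * α) * Real.cos (2 * Real.pi * q * x + Real.pi * q * α) := by
    rw [coboundary_apply, ← AddCircle.coe_add, wave_coe, wave_coe, Real.sin_sub_sin,
      show (2 * Real.pi * q * (x + α) - 2 * Real.pi * q * x) / 2 = Real.pi * q * α by ring,
      show (2 * Real.pi * q * (x + α) + 2 * Real.pi * q * x) / 2 =
        2 * Real.pi * q * x + Real.pi * q * α by ring]
  rw [this, coboundaryWave]
  push_cast
  rfl

lemma differentiable_coboundaryWave (α : ℝ) (q : ℕ) : Differentiable ℂ (coboundaryWave α q) := by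
  unfold coboundaryWave
  fun_prop

/-- A bound for `coboundaryWave α q` on the strip `|Im z| < 1`. -/
def waveBound (α : ℝ) (q : ℕ) : ℝ :=
  2 * |Real.sin (Real.pi * q * α)| * Real.exp (2 * Real.pi * q)

lemma norm_cos_le_exp_abs_im (w : ℂ) : ‖Complex.cos w‖ ≤ Real.exp |w.im| := by
  rw [Complex.cos, norm_div, RCLike.norm_ofNat, div_le_iff₀ two_pos]
  refine (norm_add_le _ _).trans ?_
  rw [Complex.norm_exp, Complex.norm_exp]
  have h1 : Real.exp (w * Complex.I).re ≤ Real.exp |w.im| :=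
    Real.exp_le_exp.2 (by simpa using neg_le_abs w.im)
  have h2 : Real.exp (-w * Complex.I).re ≤ Real.exp |w.im| :=
    Real.exp_le_exp.2 (by simpa using le_abs_self w.im)
  linarith

lemma norm_coboundaryWave_le (α : ℝ) (q : ℕ) {z : ℂ} (hz : |z.im| < 1) :
    ‖coboundaryWave α q z‖ ≤ waveBound α q := by
  rw [coboundaryWave, waveBound, norm_mul, Complex.norm_real, Real.norm_eq_abs, abs_mul, abs_two]
  gcongr
  refine (norm_cos_le_exp_abs_im _).trans (Real.exp_le_exp.2 ?_)
  have : (2 * Real.pi * q * z + Real.pi * q * α : ℂ).im = 2 * Real.pi * q * z.im := by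
    have e : (2 * Real.pi * q * z + Real.pi * q * α : ℂ) =
        ((2 * Real.pi * q : ℝ) : ℂ) * z + ((Real.pi * q * α : ℝ) : ℂ) := by push_cast; ring
    rw [e, Complex.add_im, Complex.im_ofReal_mul, Complex.ofReal_im, add_zero]
  have hnn : 0 ≤ 2 * Real.pi * (q : ℝ) := by positivity
  rw [this, abs_mul, abs_of_nonneg hnn]
  exact mul_le_of_le_one_right hnn hz.le

lemma SuperLiouville.frequently_waveBound_le {α : ℝ} (hα : SuperLiouville α) {ε : ℝ}
    (hε : 0 < ε) : ∃ᶠ q : ℕ in atTop, waveBound α q ≤ ε := by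
  have ht : Tendsto (fun q : ℕ => 2 * Real.pi * Real.exp (-(q : ℝ))) atTop (𝓝 0) := by
    simpa using ((Real.tendsto_exp_neg_atTop_nhds_zero.comp
      tendsto_natCast_atTop_atTop).const_mul (2 * Real.pi))
  obtain ⟨N, hN⟩ := eventually_atTop.1 (ht.eventually (ge_mem_nhds hε))
  rw [frequently_atTop]
  intro n
  -- Since `8 > 2π + 1`, `q ≥ 8` gives `-q² + 2πq ≤ -q`.
  obtain ⟨q, hq, p, hp⟩ := hα.2 (max (max n N) 8)
  have hq8 : (8 : ℝ) ≤ q := by exact_mod_cast (le_max_right _ _).trans hq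
  refine ⟨q, (le_max_left _ _).trans ((le_max_left _ _).trans hq), le_trans ?_
    (hN q ((le_max_right _ _).trans ((le_max_left _ _).trans hq)))⟩
  have hsin : |Real.sin (Real.pi * q * α)| ≤ Real.pi * Real.exp (-(q : ℝ) ^ 2) := by
    have e : Real.pi * q * α = Real.pi * (q * α - p) + p * Real.pi := by ring
    have h1 : |Real.sin (Real.pi * q * α)| = |Real.sin (Real.pi * (q * α - p))| := by
      rw [e, Real.sin_add_int_mul_pi, abs_mul, abs_zpow, abs_neg, abs_one, one_zpow, one_mul]
    rw [h1]
    refine Real.abs_sin_le_abs.trans ?_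
    rw [abs_mul, abs_of_pos Real.pi_pos]
    exact mul_le_mul_of_nonneg_left hp.le Real.pi_pos.le
  calc waveBound α q ≤ 2 * (Real.pi * Real.exp (-(q : ℝ) ^ 2)) * Real.exp (2 * Real.pi * q) := by
        unfold waveBound; gcongr
    _ = 2 * Real.pi * Real.exp (-(q : ℝ) ^ 2 + 2 * Real.pi * q) := by
        rw [Real.exp_add]; ring
    _ ≤ 2 * Real.pi * Real.exp (-(q : ℝ)) := by
        gcongr
        have := Real.pi_lt_d2
        nlinarith

/-- `b` is small compared with the solutions of the approximate cohomological equations of level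
`n` for `Φ`. -/
def TailSmall (α : ℝ) (n : ℕ) (Φ : C(UnitAddCircle, ℝ)) (b : ℝ) : Prop :=
  ∀ m ∈ Finset.Icc (-(n : ℤ)) n, ∀ k ∈ Finset.Icc (-(n : ℤ)) n, ∃ h : C(UnitAddCircle, ℂ),
    (∀ x, ‖(twist m k Φ x - ∫ y, twist m k Φ y) -
      (h (x + (α : UnitAddCircle)) - h x)‖ ≤ 1 / (n + 1)) ∧ b * ‖h‖ ≤ 1 / (n + 1)

lemma exists_tailSmall {α : ℝ} (hα : Irrational α) (n : ℕ) (Φ : C(UnitAddCircle, ℝ)) {b : ℝ}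
    (hb : 0 < b) : ∃ b', 0 < b' ∧ b' ≤ b ∧ TailSmall α n Φ b' := by
  have hδ : (0 : ℝ) < 1 / ((n : ℝ) + 1) := by positivity
  choose h hh using fun m k : ℤ => exists_approx_coboundary hα (twist m k Φ) hδ
  set H := ∑ m ∈ Finset.Icc (-(n : ℤ)) n, ∑ k ∈ Finset.Icc (-(n : ℤ)) n, ‖h m k‖ with hH
  have hH0 : 0 ≤ H := Finset.sum_nonneg fun m _ => Finset.sum_nonneg fun k _ => norm_nonneg _
  refine ⟨min b (1 / (n + 1) / (H + 1)), lt_min hb (by positivity), min_le_left _ _,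
    fun m hm k hk => ⟨h m k, hh m k, ?_⟩⟩
  have h1 : ‖h m k‖ ≤ H :=
    (Finset.single_le_sum (f := fun k => ‖h m k‖) (fun k _ => norm_nonneg _) hk).trans
      (Finset.single_le_sum (f := fun m => ∑ k ∈ Finset.Icc (-(n : ℤ)) n, ‖h m k‖)
        (fun m _ => Finset.sum_nonneg fun k _ => norm_nonneg _) hm)
  calc min b (1 / (n + 1) / (H + 1)) * ‖h m k‖ ≤ (1 / (n + 1) / (H + 1)) * (H + 1) := by
        gcongr
        · exact min_le_right _ _
        · linarith
    _ = 1 / (n + 1) := by field_simp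

/-- The Fejér estimates hold for all large `q` and the wave bound for infinitely many, so some `q`
satisfies both. The new tail bound `b'` is chosen only after `q`, hence after the functions `h` that
it must beat. -/
lemma exists_next_wave {α : ℝ} (hα : SuperLiouville α) (n : ℕ) (Φ : C(UnitAddCircle, ℝ)) {b : ℝ}
    (hb : 0 < b) : ∃ (q : ℕ) (b' : ℝ), 0 < b' ∧ b' ≤ b / 2 ∧ waveBound α q ≤ b / 2 ∧
      (∀ m ∈ Finset.Icc (-(n : ℤ)) n, ∀ k ∈ Finset.Icc (-(n : ℤ)) n,
        dist (∫ x, twist m k (Φ + wave q) x)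
          ((∫ x, twist m k Φ x) * ∫ x, twist 0 k (wave 1) x) ≤ 1 / (n + 1)) ∧
      TailSmall α (n + 1) (Φ + wave q) b' := by
  have hev : ∀ᶠ q : ℕ in atTop, ∀ m ∈ Finset.Icc (-(n : ℤ)) n, ∀ k ∈ Finset.Icc (-(n : ℤ)) n,
      dist (∫ x, twist m k (Φ + wave q) x)
        ((∫ x, twist m k Φ x) * ∫ x, twist 0 k (wave 1) x) ≤ 1 / (n + 1) := by
    refine (Filter.eventually_all_finset _).2 fun m _ => (Filter.eventually_all_finset _).2
      fun k _ => ?_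
    exact (tendsto_integral_twist_add_wave m k Φ).eventually
      (closedBall_mem_nhds _ (by positivity))
  obtain ⟨q, hq, hq'⟩ := ((hα.frequently_waveBound_le (half_pos hb)).and_eventually hev).exists
  obtain ⟨b', h1, h2, h3⟩ := exists_tailSmall hα.1 (n + 1) (Φ + wave q) (half_pos hb)
  exact ⟨q, b', h1, h2, hq, hq', h3⟩

/-- Here `b n` is a budget for everything added from stage `n` on: the wave of that stage uses at
most half, and the halved remainder is the next budget. -/
lemma exists_wave_sequence {α : ℝ} (hα : SuperLiouville α) {ε : ℝ} (hε : 0 < ε) :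
    ∃ (q : ℕ → ℕ) (Φ : ℕ → C(UnitAddCircle, ℝ)) (b : ℕ → ℝ), Φ 0 = 0 ∧ b 0 = ε ∧
      ∀ n, Φ (n + 1) = Φ n + wave (q n) ∧ 0 < b n ∧ b (n + 1) ≤ b n / 2 ∧
        waveBound α (q n) ≤ b n / 2 ∧
        (∀ m ∈ Finset.Icc (-(n : ℤ)) n, ∀ k ∈ Finset.Icc (-(n : ℤ)) n,
          dist (∫ x, twist m k (Φ (n + 1)) x)
            ((∫ x, twist m k (Φ n) x) * ∫ x, twist 0 k (wave 1) x) ≤ 1 / (n + 1)) ∧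
        TailSmall α (n + 1) (Φ (n + 1)) (b (n + 1)) := by
  choose Q B hB0 hB1 hQ hQ' hT using fun (n : ℕ) (σ : C(UnitAddCircle, ℝ) × {b : ℝ // 0 < b}) =>
    exists_next_wave hα n σ.1 σ.2.2
  set σ : ℕ → C(UnitAddCircle, ℝ) × {b : ℝ // 0 < b} := fun n => Nat.rec (0, ⟨ε, hε⟩)
    (fun n σ => (σ.1 + wave (Q n σ), ⟨B n σ, hB0 n σ⟩)) n with hσ
  refine ⟨fun n => Q n (σ n), fun n => (σ n).1, fun n => ((σ n).2 : ℝ), rfl, rfl, fun n => ?_⟩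
  exact ⟨rfl, (σ n).2.2, hB1 n (σ n), hQ n (σ n), hQ' n (σ n), hT n (σ n)⟩

lemma tendsto_zero_of_contraction {a d : ℕ → ℝ} {ρ : ℝ} (ha0 : ∀ n, 0 ≤ a n) (ha1 : ∀ n, a n ≤ 1)
    (hρ0 : 0 ≤ ρ) (hρ1 : ρ < 1) (hd : Tendsto d atTop (𝓝 0))
    (h : ∀ᶠ n in atTop, a (n + 1) ≤ ρ * a n + d n) : Tendsto a atTop (𝓝 0) := by
  rw [Metric.tendsto_atTop]
  intro ε hε
  -- With this bound on `d`, the level `ε / 2` is preserved by the recursion.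
  have hd' : ∀ᶠ n in atTop, d n ≤ (1 - ρ) * (ε / 2) :=
    hd.eventually (ge_mem_nhds (mul_pos (by linarith) (half_pos hε)))
  obtain ⟨N, hN⟩ := eventually_atTop.1 (h.and hd')
  have hind : ∀ j, a (N + j) ≤ ρ ^ j + ε / 2 := by
    intro j
    induction j with
    | zero => simpa using (ha1 N).trans (by linarith)
    | succ j ih =>
      obtain ⟨h1, h2⟩ := hN (N + j) (Nat.le_add_right _ _)
      have h3 : ρ * a (N + j) ≤ ρ * (ρ ^ j + ε / 2) := mul_le_mul_of_nonneg_left ih hρ0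
      rw [pow_succ]
      have e : N + (j + 1) = N + j + 1 := rfl
      rw [e]
      linarith
  obtain ⟨M, hM⟩ := eventually_atTop.1 ((tendsto_pow_atTop_nhds_zero_of_lt_one hρ0 hρ1).eventually
    (gt_mem_nhds (half_pos hε)))
  refine ⟨N + M, fun n hn => ?_⟩
  obtain ⟨j, rfl⟩ := Nat.exists_eq_add_of_le ((Nat.le_add_right N M).trans hn)
  rw [Real.dist_0_eq_abs, abs_of_nonneg (ha0 _)]
  linarith [hind j, hM j (by omega)]

lemma analyticOnNhd_of_complex_extension {ψ : C(UnitAddCircle, ℝ)} {Ψ : ℂ → ℂ}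
    (hd : DifferentiableOn ℂ Ψ {z | |z.im| < 1}) (hΨ : ∀ x : ℝ, Ψ x = (ψ (x : UnitAddCircle) : ℝ)) :
    AnalyticOnNhd ℝ (fun x : ℝ => ψ (x : UnitAddCircle)) univ := by
  intro x _
  have hopen : IsOpen {z : ℂ | |z.im| < 1} := isOpen_lt (by fun_prop) continuous_const
  have h1 : AnalyticAt ℝ Ψ (x : ℂ) :=
    ((hd.analyticOnNhd hopen) (x : ℂ) (by simp)).restrictScalars
  have h2 : AnalyticAt ℝ (fun x : ℝ => Ψ x) x :=
    h1.fun_comp (f := fun x : ℝ => (x : ℂ)) (Complex.ofRealCLM.analyticAt x)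
  have h3 : AnalyticAt ℝ (fun x : ℝ => (Ψ x).re) x :=
    (Complex.reCLM.analyticAt _).fun_comp h2
  simpa only [hΨ, Complex.ofReal_re] using h3

lemma analyticOnNhd_wave (q : ℕ) :
    AnalyticOnNhd ℝ (fun x : ℝ => wave q (x : UnitAddCircle)) univ := by
  intro x _
  simp only [wave_coe]
  exact Real.analyticAt_sin.fun_comp (analyticAt_const.mul analyticAt_id)

/-- Over a super-Liouville rotation there is an arbitrarily small analytic function, approximated
by analytic coboundaries, whose skew product is uniquely ergodic. -/
lemma exists_uniquelyErgodic_cocycle {α : ℝ} (hα : SuperLiouville α) {ε : ℝ} (hε : 0 < ε) :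
    ∃ (ψ : C(UnitAddCircle, ℝ)) (Ψ : ℂ → ℂ) (Φ : ℕ → C(UnitAddCircle, ℝ)) (Θ : ℕ → ℂ → ℂ)
      (b : ℕ → ℝ), DifferentiableOn ℂ Ψ {z | |z.im| < 1} ∧
      (∀ x : ℝ, Ψ x = (ψ (x : UnitAddCircle) : ℝ)) ∧ (∀ z : ℂ, |z.im| < 1 → ‖Ψ z‖ ≤ ε) ∧
      (∀ n, AnalyticOnNhd ℝ (fun x : ℝ => Φ n (x : UnitAddCircle)) univ) ∧
      (∀ n, Differentiable ℂ (Θ n)) ∧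
      (∀ n (x : ℝ), Θ n x = (coboundary α (Φ n) (x : UnitAddCircle) : ℝ)) ∧
      (∀ n (z : ℂ), |z.im| < 1 → ‖Ψ z - Θ n z‖ ≤ b n) ∧ Tendsto b atTop (𝓝 0) ∧
      UniquelyErgodic (skewHomeomorph α ψ) := by
  obtain ⟨q, Φ, b, hΦ0, hb0, hall⟩ := exists_wave_sequence hα hε
  choose hΦ hbpos hbhalf hwave hdist htail using hall
  have hbgeom : ∀ n i, b (n + i) ≤ b n / 2 ^ i := by
    intro n i
    induction i with
    | zero => simp
    | succ i ih =>
      refine (hbhalf (n + i)).trans ?_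
      rw [pow_succ, ← div_div]
      linarith
  have hbound : ∀ n i (z : ℂ), |z.im| < 1 →
      ‖coboundaryWave α (q (i + n)) z‖ ≤ b n / 2 / 2 ^ i := by
    intro n i z hz
    refine (norm_coboundaryWave_le α _ hz).trans ((hwave _).trans ?_)
    rw [add_comm i n, div_right_comm]
    exact div_le_div_of_nonneg_right (hbgeom n i) two_pos.le
  set Ψ : ℂ → ℂ := fun z => ∑' i, coboundaryWave α (q i) z with hΨ
  set Θ : ℕ → ℂ → ℂ := fun n z => ∑ i ∈ Finset.range n, coboundaryWave α (q i) z with hΘ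
  have hsum : ∀ z : ℂ, |z.im| < 1 → Summable fun i => coboundaryWave α (q i) z := fun z hz =>
    Summable.of_norm_bounded (hasSum_geometric_two' (b 0)).summable fun i => hbound 0 i z hz
  have htl : ∀ n (z : ℂ), |z.im| < 1 → ‖Ψ z - Θ n z‖ ≤ b n := by
    intro n z hz
    have : Ψ z - Θ n z = ∑' i, coboundaryWave α (q (i + n)) z := by
      rw [sub_eq_iff_eq_add', hΨ, hΘ]
      exact ((hsum z hz).sum_add_tsum_nat_add n).symm
    rw [this]
    exact tsum_of_norm_bounded (hasSum_geometric_two' (b n)) fun i => hbound n i z hz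
  have hΘd : ∀ n, Differentiable ℂ (Θ n) := fun n =>
    Differentiable.fun_sum fun i _ => differentiable_coboundaryWave α (q i)
  have hΘx : ∀ n (x : ℝ), Θ n x = (coboundary α (Φ n) (x : UnitAddCircle) : ℝ) := by
    intro n x
    induction n with
    | zero => simp [hΘ, hΦ0, coboundary_apply]
    | succ n ih =>
      simp only [hΘ] at ih ⊢
      rw [Finset.sum_range_succ, ih, coboundaryWave_ofReal, hΦ, coboundary_add]
      simp
  have hd : DifferentiableOn ℂ Ψ {z | |z.im| < 1} :=
    Complex.differentiableOn_tsum_of_summable_norm (hasSum_geometric_two' (b 0)).summable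
      (fun i => (differentiable_coboundaryWave α (q i)).differentiableOn)
      (isOpen_lt (by fun_prop) continuous_const) fun i z hz => hbound 0 i z hz
  have hcw : ∀ i (x : UnitAddCircle), ‖coboundary α (wave (q i)) x‖ ≤ b 0 / 2 / 2 ^ i := by
    intro i x
    obtain ⟨y, rfl⟩ := QuotientAddGroup.mk_surjective x
    have := hbound 0 i (y : ℂ) (by simp)
    rw [add_zero, coboundaryWave_ofReal, Complex.norm_real] at this
    exact this
  set ψ : C(UnitAddCircle, ℝ) := ⟨fun x => ∑' i, coboundary α (wave (q i)) x,
    continuous_tsum (fun i => (coboundary α (wave (q i))).continuous)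
      (hasSum_geometric_two' (b 0)).summable hcw⟩ with hψ
  have hΨx : ∀ x : ℝ, Ψ x = (ψ (x : UnitAddCircle) : ℝ) := by
    intro x
    simp only [hΨ, hψ, ContinuousMap.coe_mk, coboundaryWave_ofReal, Complex.ofReal_tsum]
  have hbt : Tendsto b atTop (𝓝 0) := by
    have h1 : Tendsto (fun n : ℕ => b 0 / 2 ^ n) atTop (𝓝 0) := by
      have := (tendsto_pow_atTop_nhds_zero_of_lt_one (r := (1 / 2 : ℝ)) (by norm_num)
        (by norm_num)).const_mul (b 0)
      simpa [div_eq_mul_inv] using this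
    refine squeeze_zero (fun n => (hbpos n).le) (fun n => ?_) h1
    simpa using hbgeom 0 n
  refine ⟨ψ, Ψ, Φ, Θ, b, hd, hΨx, ?_, ?_, hΘd, hΘx, htl, hbt, ?_⟩
  · intro z hz
    have := htl 0 z hz
    rw [← hb0]
    simpa [hΘ] using this
  · intro n
    induction n with
    | zero => rw [hΦ0]; exact fun x _ => analyticAt_const
    | succ n ih => rw [hΦ]; exact ih.add (analyticOnNhd_wave (q n))
  · have hmem : ∀ m : ℤ, ∀ᶠ n : ℕ in atTop, m ∈ Finset.Icc (-(n : ℤ)) n := fun m => by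
      filter_upwards [eventually_ge_atTop m.natAbs] with n hn
      rw [Finset.mem_Icc]; omega
    refine uniquelyErgodic_skew hα.1 (Φ := Φ) (b := b) ?_ ?_ ?_
    · intro n x
      obtain ⟨y, rfl⟩ := QuotientAddGroup.mk_surjective x
      have := htl n (y : ℂ) (by simp)
      rw [hΨx, hΘx, ← Complex.ofReal_sub, Complex.norm_real] at this
      exact this
    · intro m k hk
      rw [tendsto_zero_iff_norm_tendsto_zero]
      -- As soon as `n ≥ |m|, |k|`, each stage contracts the mean by this factor up to `1 / (n +
      -- 1)`.
      refine tendsto_zero_of_contraction (ρ := ‖∫ x, twist 0 k (wave 1) x‖)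
        (d := fun n : ℕ => 1 / ((n : ℝ) + 1)) (fun n => norm_nonneg _) (fun n => ?_)
        (norm_nonneg _) (norm_integral_twist_wave_lt_one hk)
        tendsto_one_div_add_atTop_nhds_zero_nat ?_
      · simpa using norm_integral_le_of_norm_le_const (μ := volume)
          (Eventually.of_forall fun x => (norm_twist_apply m k (Φ n) x).le)
      · filter_upwards [hmem m, hmem k] with n hm hk'
        have h1 := hdist n m hm k hk'
        rw [dist_eq_norm] at h1
        have h2 := norm_le_norm_add_norm_sub' (∫ x, twist m k (Φ (n + 1)) x)
          ((∫ x, twist m k (Φ n) x) * ∫ x, twist 0 k (wave 1) x)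
        rw [norm_mul] at h2
        linarith
    · intro m k
      filter_upwards [hmem m, hmem k, eventually_ge_atTop 1] with n hm hk hn
      -- Stage `j` of the construction controls the tail at level `j + 1`, so level `0` is excluded.
      obtain ⟨j, rfl⟩ := Nat.exists_eq_add_of_le' hn
      exact htail j m hm k hk

/-! ### Density of unique ergodicity -/

/-- The rotation `R_α` as an element of `Diff`. -/
def rotationDiff (α : ℝ) : Diff :=
  skewDiff α 0 (fun _ _ => analyticAt_const)

lemma exists_uniquelyErgodic_near_rotation {α : ℝ} (hα : SuperLiouville α) {O : Set Diff}
    (hO : IsOpen O) (hR : rotationDiff α ∈ O) :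
    ∃ G ∈ O, G ∈ closure (conjugates α) ∧ UniquelyErgodic G.toHomeomorph := by
  -- All skew products involved are represented in `𝒟_1`, so only the strip of width `1` matters.
  obtain ⟨U, hU, hUO⟩ := hO 1 one_pos
  obtain ⟨φ₀, hφ₀, hφ₀R⟩ := exists_skew_displacement one_pos α (ψ := 0) (Ψ := 0) (M := 0)
    (fun _ _ => analyticAt_const) (differentiableOn_const 0) (by simp) (by simp)
  obtain ⟨κ, hκ, hball⟩ := Metric.isOpen_iff.1 hU _ ((hUO _ _ hφ₀R).2 hR)
  obtain ⟨ψ, Ψ, Φ, Θ, b, hd, hΨ, hΨε, hΦa, hΘd, hΘ, hb, hbt, hUE⟩ :=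
    exists_uniquelyErgodic_cocycle hα (half_pos hκ)
  obtain ⟨φ, hφ, hφG⟩ := exists_skew_displacement one_pos α
    (analyticOnNhd_of_complex_extension hd hΨ) hd hΨε hΨ
  refine ⟨_, (hUO _ _ hφG).1 (hball ?_), ?_, hUE⟩
  · refine lt_of_le_of_lt (dist_le_of_dispExt (half_pos hκ).le fun z hz => ?_) (half_lt_self hκ)
    rw [hφ z hz, hφ₀ z hz]
    refine max_le ?_ ?_
    · simpa using (half_pos hκ).le
    · simpa using hΨε z.1 hz.1
  -- The skew products of the coboundaries of `Φ n` are conjugate to the rotation and converge to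
  -- the limit in `𝒟_1`.
  · rw [_root_.mem_closure_iff]
    intro O' hO' hGO'
    obtain ⟨U', hU', hUO'⟩ := hO' 1 one_pos
    obtain ⟨κ', hκ', hball'⟩ := Metric.isOpen_iff.1 hU' _ ((hUO' _ _ hφG).2 hGO')
    obtain ⟨n, hn⟩ := (hbt.eventually (gt_mem_nhds hκ')).exists
    have hbn : 0 ≤ b n := (norm_nonneg _).trans (hb n 0 (by simp))
    have hΘb : ∀ z : ℂ, |z.im| < 1 → ‖Θ n z‖ ≤ κ / 2 + b n := fun z hz => by
      have h1 := norm_le_norm_add_norm_sub' (Θ n z) (Ψ z)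
      rw [norm_sub_rev] at h1
      linarith [hΨε z hz, hb n z hz]
    obtain ⟨φ', hφ', hφG'⟩ := exists_skew_displacement one_pos α
      (analyticOnNhd_of_complex_extension (hΘd n).differentiableOn (hΘ n))
      (hΘd n).differentiableOn hΘb (hΘ n)
    refine ⟨_, (hUO' _ _ hφG').1 (hball' ?_),
      skewDiff_mem_conjugates _ (hΦa n) fun x => coboundary_apply α (Φ n) x⟩
    refine lt_of_le_of_lt (dist_le_of_dispExt hbn fun z hz => ?_) hn
    rw [hφ' z hz, hφ z hz]
    refine max_le ?_ ?_
    · simpa using hbn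
    · rw [dist_comm, dist_eq_norm]; exact hb n z.1 hz.1

lemma conjDiff_mem_conjugates {α : ℝ} {T : AnalyticDiffeo}
    (hT : MeasurePreserving T.toHomeomorph volume volume) {F : Diff} (hF : F ∈ conjugates α) :
    conjDiff T F ∈ conjugates α := by
  obtain ⟨T', hT', h⟩ := hF
  exact ⟨⟨T.toHomeomorph.trans T'.toHomeomorph, T'.analytic.comp T.analytic,
    T.analytic_symm.comp T'.analytic_symm⟩, hT'.comp hT, fun p => by
      rw [conjDiff_apply, h]; rfl⟩

lemma UniquelyErgodic.conjDiff {F : Diff} (hF : UniquelyErgodic F.toHomeomorph)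
    (T : AnalyticDiffeo) : UniquelyErgodic (conjDiff T F).toHomeomorph := by
  obtain ⟨μ, ⟨hμ, hμF⟩, huniq⟩ := hF
  set t := T.toHomeomorph with ht
  have htm : Measurable t := t.continuous.measurable
  have hsm : Measurable t.symm := t.symm.continuous.measurable
  have hFm : Measurable F.toHomeomorph := F.toHomeomorph.continuous.measurable
  have hcoe : ⇑(AnalyticTorus.conjDiff T F).toHomeomorph = t.symm ∘ F.toHomeomorph ∘ t := rfl
  refine ⟨μ.map t.symm, ⟨Measure.isProbabilityMeasure_map hsm.aemeasurable, ?_⟩, ?_⟩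
  · refine ⟨(AnalyticTorus.conjDiff T F).toHomeomorph.continuous.measurable, ?_⟩
    rw [hcoe, Measure.map_map (hsm.comp (hFm.comp htm)) hsm]
    have e : (t.symm ∘ F.toHomeomorph ∘ t) ∘ t.symm = t.symm ∘ F.toHomeomorph := by
      ext1 p; simp
    rw [e, ← Measure.map_map hsm hFm, hμF.map_eq]
  · rintro ν ⟨hν, hνF⟩
    have h1 : ν.map t = μ := by
      refine huniq _ ⟨Measure.isProbabilityMeasure_map htm.aemeasurable, hFm, ?_⟩
      have e : F.toHomeomorph ∘ t = t ∘ (t.symm ∘ F.toHomeomorph ∘ t) := by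
        ext1 p; simp
      rw [Measure.map_map hFm htm, e, ← hcoe, ← Measure.map_map htm hνF.measurable, hνF.map_eq]
    rw [← h1, Measure.map_map hsm htm, t.symm_comp_self, Measure.map_id]

end AnalyticTorus

end

theorem theoremA :
    ∃ S : Set (Set.Icc (0 : ℝ) 1), IsGδ S ∧ Dense S ∧ ∀ α ∈ S,
      Dense {F : closure (AnalyticTorus.conjugates α) |
        AnalyticTorus.UniquelyErgodic F.1.toHomeomorph} := by
  open AnalyticTorus in
  obtain ⟨hG, hD⟩ := isGδ_superLiouville
  refine ⟨(↑) ⁻¹' {α : ℝ | SuperLiouville α}, hG.preimage continuous_subtype_val,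
    dense_preimage_Icc hD, fun α hα => ?_⟩
  rw [dense_iff_inter_open]
  rintro V hV ⟨⟨F₀, hF₀⟩, hF₀V⟩
  obtain ⟨O, hO, rfl⟩ := isOpen_induced_iff.1 hV
  -- Replacing `F₀` by an actual conjugate `F` of the rotation in `O` makes the preimage of `O`
  -- under conjugation by `T` a neighbourhood of `R_α`.
  obtain ⟨F, hFO, T, hT, hF⟩ := mem_closure_iff.1 hF₀ O hO hF₀V
  have hFR : conjDiff T (rotationDiff α) = F := Diff.ext_toHomeomorph fun p => by
    rw [hF, conjDiff_apply]
    congr 1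
    simp [rotationDiff, skewDiff, skewHomeomorph_apply, torusRotation]
  obtain ⟨G, hGO, hGcl, hGE⟩ := exists_uniquelyErgodic_near_rotation hα
    (hO.preimage (continuous_conjDiff T)) (by rw [Set.mem_preimage, hFR]; exact hFO)
  have hmaps : Set.MapsTo (conjDiff T) (conjugates α) (conjugates α) := fun H hH =>
    conjDiff_mem_conjugates hT hH
  exact ⟨⟨conjDiff T G, map_mem_closure (continuous_conjDiff T) hGcl hmaps⟩, hGO, hGE.conjDiff T⟩
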